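/- **Setting.** Let $T$ be a finite simplicial complex, pure of dimension $n$ (for example a triangulation of a compact $n$-manifold, possibly with boundary), with an arbitrarily chosen orientation of every simplex and incidence numbers $O(p,q)\in\{0,\pm1\}$. Let $k,d\ge 0$, write $\mathbb Z_d=\mathbb Z/d\mathbb Z$ (so $\mathbb Z_0=\mathbb Z$), and let $\zeta$ be a complex number of modulus $1$ and of exact multiplicative order $d$ (infinite order if $d=0$). States are functions $\psi: C_k(T;\mathbb Z_d)\to\mathbb C$; for $d\geq 1$ this is $\bigotimes_{\beta\in T_k}\mathbb C^d$. For a $k$-cell $\beta$ let $X_\beta|c\rangle=|c+\beta\rangle$ and $Z_\beta|c\rangle=\zeta^{c_\beta}|c\rangle$. The stabilizers are $V_\alpha=\prod_{\beta\in T_k}Z_\beta^{O(\beta,\alpha)}$ for $\alpha\in T_{k-1}$ and $P_\gamma=\prod_{\beta\in T_k}X_\beta^{O(\gamma,\beta)}$ for $\gamma\in T_{k+1}$; the code space is their common $1$-eigenspace, its elements are the ground states, and a stabilizer $S$ is broken in a state $\varphi$ if $S\varphi\ne\varphi$. The dual complex $\widehat T$ has an $(n-j)$-cell $\widehat\Delta$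 for each $j$-simplex $\Delta$, and $\hat\partial\widehat\Delta=\sum_{i}O(i,\Delta)\,\widehat i$ over the $(j+1)$-simplices $i$. Its closure $cl(\widehat T)=\widehat T\cup\partial\widehat T$ has in addition an $(n-1-j)$-cell for each $j$-simplex $s$ of $\partial T$ (the subcomplex generated by the $(n-1)$-simplices that lie in exactly one $n$-simplex), pasted to the boundary of $\widehat s$. An oriented $m$-pseudo-manifold is a finite, nonempty, pure $m$-dimensional complex in which every $(m-1)$-cell lies in one or two $m$-cells (in one: a boundary cell), any two $m$-cells are joined by a chain of $m$-cells with consecutive ones sharing an $(m-1)$-cell, and the $m$-cells are oriented so that two $m$-cells sharing an $(m-1)$-cell induce opposite orientations on it. A (degree-1) $V$-error sub-pseudo-manifold is a simplicial immersion (locally injective simplicial map) $f:R\to T$ of an oriented simplicial $k$-pseudo-manifold; its chain is $\rho=\sum_{r\in R_k}O(f(r),r)f(r)$ and its operator is $\prod_{r\in R_k}X_{f(r)}^{O(f(r),r)}$, where $O(f(r),r)=\pm1$ compares orientations. A (degree-1) $P$-error sub-cellulation is a locally injective cellular map $f:R\to cl(\widehat T)$ of an oriented regular cell complex $R$ with the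 structure of an $(n-k)$-pseudo-manifold, which maps each closed cell of $R$ isomorphically onto a closed cell and $(n-k)$-cells to cells of $\widehat T$, the orientations of the $(n-k)$-cells of $R$ being compared through $f$ with those that define $\hat\partial$; its chain is $\widehat\rho=\sum_{r\in R_{n-k}}O(f(r),r)f(r)\in C_{n-k}(\widehat T)$ and its operator is $\prod_{r\in R_{n-k}} Z_{\widehat{f(r)}}^{O(f(r),r)}$, where $\widehat{f(r)}$ is the $k$-cell of $T$ dual to $f(r)$. **Lemma.** (1) Let $E$ be the operator of a $V$-error sub-pseudo-manifold $f:R\to T$ with chain $\rho$. Then $\partial\rho=f_*(\partial R)$. For every ground state $\psi\ne0$, no $P_\gamma$ is broken in $E\psi$, and $V_\alpha$ is broken in $E\psi$ if and only if the coefficient of $\alpha$ in $\partial\rho$ is nonzero in $\mathbb Z_d$; if $f$ is injective on vertices and $d\neq 1$, these are exactly the images of the boundary $(k-1)$-cells of $R$. The error is detectable only up to boundaries of $(k+1)$-cells: for an integral $k$-chain $a$, $\prod_\beta X_\beta^{a_\beta}\psi=E\psi$ for all ground states $\psi$ if and only if $a-\rho$ is, modulo $d$, a boundary of a $(k+1)$-chain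 over $\mathbb Z_d$. (2) Let $E$ be the operator of a $P$-error sub-cellulation $f:R\to cl(\widehat T)$ with chain $\widehat\rho$. Then, in $\widehat T$, $\hat\partial\widehat\rho$ is the image of the oriented boundary of $R$ (boundary cells mapped to $\partial\widehat T$ being ignored). For every ground state $\psi\neq0$, no $V_\alpha$ is broken in $E\psi$, and $P_\gamma$ is broken in $E\psi$ if and only if the coefficient of the $(n-k-1)$-cell $\widehat\gamma$ in $\hat\partial\widehat\rho$ is nonzero in $\mathbb Z_d$; if $f$ is injective and $d\ne1$, these $\widehat\gamma$ are exactly the cells of $\widehat T$ that are images of boundary cells of $R$. If, modulo $d$, $\sum_\beta a_\beta\widehat\beta-\widehat\rho$ is a $\hat\partial$-boundary of a chain of dual $(n-k+1)$-cells $\widehat\alpha$, $\alpha\in T_{k-1}$ (that is, a combination of coboundaries of $(k-1)$-cells), then $\prod_\beta Z_\beta^{a_\beta}\psi=E\psi$ for all ground states $\psi$; for $d\ge1$ the converse holds as well. (3) Let $V$-errors and $P$-errors be given on the $k$-cells, with degrees $\deg_V(\beta),\deg_P(\beta)\in\mathbb N$ (less than $d$ if $d\geq1$) and orientations $u_V(\beta),u_P(\beta)\in\{\pm1\}$;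 an error of degree $l$ counts as $l$ degree-1 errors on the same cell with the same orientation. Then there are finite sequences $R_1,\dots,R_N$ of $V$-error sub-pseudo-manifolds and $S_1,\dots,S_M$ of $P$-error sub-cellulations such that: - their top-dimensional cells use each given degree-1 error exactly once, with the given orientation, so the products of their operators are $\prod_\beta X_\beta^{u_V(\beta)\deg_V(\beta)}$ and $\prod_\beta Z_\beta^{u_P(\beta)\deg_P(\beta)}$; - each piece is maximally connected among the degree-1 errors not used by the preceding pieces of the same type: every orientation-preserving map over $T$ (resp. $cl(\widehat T)$), injective on top-dimensional cells, from it to another error sub-pseudo-manifold (resp. sub-cellulation) made of such errors is an isomorphism, so neither can further errors be stitched to its boundary nor can parts of its boundary be stitched together; - for every ground state $\psi\ne0$, in the state $\prod_\beta X_\beta^{u_V(\beta)\deg_V(\beta)}\prod_\beta Z_\beta^{u_P(\beta)\deg_P(\beta)}\psi$ the broken $V$-stabilizers are those on the cells with nonzero coefficient in $\mathbb Z_d$ in the sum of the boundary chains of the $R_j$, and the broken $P$-stabilizers are those on the dual cells of $\widehat T$ with nonzero coefficient in the sum of the boundary chains of the $S_j$; - if the orientations of the $V$-errors are compatible (whenever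 two different cells carrying $V$-errors have a common $(k-1)$-cell $\alpha$, then $\alpha$ agrees with the orientation of one and disagrees with that of the other), then $V_\alpha$ is broken if and only if $\alpha$ is the image of a boundary cell of some $R_j$; likewise, if the orientations of the $P$-errors are compatible (the same condition for the dual $(n-k)$-cells and their common $(n-k-1)$-cells in $\widehat T$), then $P_\gamma$ is broken if and only if $\widehat\gamma$ is the image of a boundary cell of some $S_j$. -/

import Mathlib

universe u

noncomputable section

open Classical

namespace HomologyCode

/-! ### Simplicial complexes, orientations, chains -/

/-- The `j`-cells (`j`-simplices, i.e. faces with `j + 1` vertices) of a simplicial complex. The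
dimension is an integer, so that there are no cells of dimension `-1` (faces are nonempty). -/
def Cell {V : Type u} (T : AbstractSimplicialComplex V) (j : ℤ) : Type u :=
  {s : Finset V // s ∈ T.faces ∧ (s.card : ℤ) = j + 1}

instance {V : Type u} [Fintype V] (T : AbstractSimplicialComplex V) (j : ℤ) :
    Fintype (Cell T j) :=
  inferInstanceAs (Fintype {s : Finset V // s ∈ T.faces ∧ (s.card : ℤ) = j + 1})

/-- `T` has dimension `n` and every simplex is a face of an `n`-simplex. -/
def IsPure {V : Type u} (T : AbstractSimplicialComplex V) (n : ℕ) : Prop :=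
  ∀ s ∈ T.faces, ∃ t : Cell T n, s ⊆ t.1

/-- A choice of orientation of every simplex on the vertex set `V`: an orientation is a class of
enumerations of the vertices up to even permutations, and `sgn v = 1` means that the enumeration
`v` belongs to the chosen class. -/
structure Orientation (V : Type u) where
  sgn : ∀ {m : ℕ}, (Fin m → V) → ℤˣ
  alternating : ∀ {m : ℕ} (v : Fin m → V), Function.Injective v →
    ∀ π : Equiv.Perm (Fin m), sgn (v ∘ π) = Equiv.Perm.sign π * sgn v

/-- Some enumeration of the vertices of `s`. Nothing below depends on which one it is. -/
def enum {V : Type u} (s : Finset V) : Fin s.card → V := fun i => (s.equivFin.symm i : V)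

/-- The incidence number `O(p, q)`: if `q` is the face of `p` opposite to a vertex `x`, it is `1` or
`-1` according to whether the orientation that `p` induces on `q` (`x` first, then `q`) is the
chosen orientation of `q`; it is `0` if `q` is not a codimension one face of `p`. -/
def Orientation.inc {V : Type u} (o : Orientation V) (p q : Finset V) : ℤ :=
  ∑ x ∈ p, if p.erase x = q then
    ((o.sgn (Fin.cons x (enum q) : Fin (q.card + 1) → V) * o.sgn (enum q) : ℤˣ) : ℤ) else 0

/-- For a map `f` of vertices that is injective on the simplex `s`: the sign `O(f(s), s)`, which is
`1` if `f` carries the chosen orientation of `s` to the chosen orientation of `f(s)`, and `-1`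
otherwise. -/
def relSign {W V : Type u} (oW : Orientation W) (oV : Orientation V) (f : W → V) (s : Finset W) :
    ℤˣ :=
  oV.sgn (f ∘ enum s) * oW.sgn (enum s)

section Chains

variable {V : Type u} [Fintype V] {T : AbstractSimplicialComplex V}

/-- The simplicial boundary of an `i`-chain, as a `j`-chain (used with `j = i - 1`). -/
def boundary (o : Orientation V) {A : Type} [CommRing A] {i j : ℤ} (c : Cell T i → A) :
    Cell T j → A :=
  fun α => ∑ β : Cell T i, (o.inc β.1 α.1 : A) * c β

/-- The boundary map of the dual chain complex. A function `c` on the `i`-cells of `T` stands for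
the chain `∑ c β • β̂` of dual cells, and `∂̂ β̂ = ∑ O(γ, β) γ̂` over the cells `γ` cobounding `β`
(used with `j = i + 1`). -/
def dualBoundary (o : Orientation V) {A : Type} [CommRing A] {i j : ℤ} (c : Cell T i → A) :
    Cell T j → A :=
  fun γ => ∑ β : Cell T i, (o.inc γ.1 β.1 : A) * c β

end Chains

/-! ### The code -/

section Code

variable {V : Type u} (T : AbstractSimplicialComplex V) (k : ℤ) (d : ℕ)

/-- The state space: a qudit on every `k`-cell. A state is a function on the `k`-chains with
coefficients in `ℤ/d`; the basis vector `|c⟩` is the indicator function of `c`. For `d > 0` this is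
the tensor power of `ℂ^d` over the `k`-cells; for `d = 0` these are the functions on integral
chains. -/
abbrev State : Type u := (Cell T k → ZMod d) → ℂ

variable {T k d}

/-- The generalized Pauli operator `X` at the cell `β`, `X |c⟩ = |c + β⟩`. -/
def pauliX (β : Cell T k) : State T k d ≃ₗ[ℂ] State T k d where
  toFun ψ := fun c => ψ (c - Pi.single β 1)
  invFun ψ := fun c => ψ (c + Pi.single β 1)
  map_add' _ _ := rfl
  map_smul' _ _ := rfl
  left_inv ψ := by funext c; simp
  right_inv ψ := by funext c; simp

/-- The generalized Pauli operator `Z` at the cell `β`, `Z |c⟩ = ζ ^ (c β) |c⟩`. -/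
def pauliZ (ζ : Circle) (β : Cell T k) : State T k d ≃ₗ[ℂ] State T k d where
  toFun ψ := fun c => (ζ : ℂ) ^ ((c β).cast : ℤ) * ψ c
  invFun ψ := fun c => ((ζ : ℂ) ^ ((c β).cast : ℤ))⁻¹ * ψ c
  map_add' _ _ := by funext c; simp [mul_add]
  map_smul' _ _ := by funext c; simp; ring
  left_inv ψ := by
    funext c
    exact inv_mul_cancel_left₀ (zpow_ne_zero _ (Circle.coe_ne_zero ζ)) (ψ c)
  right_inv ψ := by
    funext c
    exact mul_inv_cancel_left₀ (zpow_ne_zero _ (Circle.coe_ne_zero ζ)) (ψ c)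

theorem pauliX_comm (β β' : Cell T k) : Commute (pauliX (d := d) β) (pauliX β') := by
  ext ψ c
  show ψ (c - Pi.single β 1 - Pi.single β' 1) = ψ (c - Pi.single β' 1 - Pi.single β 1)
  rw [sub_right_comm]

theorem pauliZ_comm (ζ : Circle) (β β' : Cell T k) :
    Commute (pauliZ (d := d) ζ β) (pauliZ ζ β') := by
  ext ψ c
  show (ζ : ℂ) ^ ((c β).cast : ℤ) * ((ζ : ℂ) ^ ((c β').cast : ℤ) * ψ c)
    = (ζ : ℂ) ^ ((c β').cast : ℤ) * ((ζ : ℂ) ^ ((c β).cast : ℤ) * ψ c)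
  ring

variable [Fintype V]

/-- The product over a finite index set of powers of `X` at given cells. -/
def prodX {ι : Type u} [Fintype ι] (cell : ι → Cell T k) (e : ι → ℤ) :
    State T k d ≃ₗ[ℂ] State T k d :=
  Finset.univ.noncommProd (fun i => pauliX (cell i) ^ e i)
    (fun i _ j _ _ => (pauliX_comm (cell i) (cell j)).zpow_zpow (e i) (e j))

/-- The product over a finite index set of powers of `Z` at given cells. -/
def prodZ (ζ : Circle) {ι : Type u} [Fintype ι] (cell : ι → Cell T k) (e : ι → ℤ) :
    State T k d ≃ₗ[ℂ] State T k d :=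
  Finset.univ.noncommProd (fun i => pauliZ ζ (cell i) ^ e i)
    (fun i _ j _ _ => (pauliZ_comm ζ (cell i) (cell j)).zpow_zpow (e i) (e j))

/-- The error that applies `X ^ (a β)` at every `k`-cell `β`. -/
def errorX (a : Cell T k → ℤ) : State T k d ≃ₗ[ℂ] State T k d := prodX id a

/-- The error that applies `Z ^ (a β)` at every `k`-cell `β`. -/
def errorZ (ζ : Circle) (a : Cell T k → ℤ) : State T k d ≃ₗ[ℂ] State T k d := prodZ ζ id a

/-- The stabilizer `V_α = ∏ Z_β ^ O(β, α)`, over the `k`-cells `β` cobounding the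
`(k-1)`-cell `α`. -/
def stabV (o : Orientation V) (ζ : Circle) (α : Cell T (k - 1)) :
    State T k d ≃ₗ[ℂ] State T k d :=
  errorZ ζ fun β => o.inc β.1 α.1

/-- The stabilizer `P_γ = ∏ X_β ^ O(γ, β)`, over the `k`-cells `β` on the boundary of the
`(k+1)`-cell `γ`. -/
def stabP (o : Orientation V) (γ : Cell T (k + 1)) : State T k d ≃ₗ[ℂ] State T k d :=
  errorX fun β => o.inc γ.1 β.1

/-- The code space: the common `1`-eigenspace of all stabilizers. -/
def codeSpace (o : Orientation V) (ζ : Circle) : Set (State T k d) :=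
  {ψ | (∀ α, stabV o ζ α ψ = ψ) ∧ ∀ γ, stabP o γ ψ = ψ}

/-- The stabilizer `S` is broken in the state `φ`. -/
def Broken (S : State T k d ≃ₗ[ℂ] State T k d) (φ : State T k d) : Prop := S φ ≠ φ

end Code

/-! ### `V`-error sub-pseudo-manifolds -/

/-- A connected oriented `m`-pseudo-manifold with (possibly empty) boundary. -/
structure IsOrientedPseudomanifold {W : Type u} (R : AbstractSimplicialComplex W)
    (o : Orientation W) (m : ℕ) : Prop where
  nonempty : Nonempty (Cell R m)
  pure : ∀ s ∈ R.faces, ∃ ρ : Cell R m, s ⊆ ρ.1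
  one_or_two : ∀ τ : Cell R (m - 1),
    {ρ : Cell R m | τ.1 ⊆ ρ.1}.ncard = 1 ∨ {ρ : Cell R m | τ.1 ⊆ ρ.1}.ncard = 2
  connected : ∀ ρ ρ' : Cell R m,
    Relation.ReflTransGen
      (fun a b : Cell R m => ∃ τ : Cell R (m - 1), τ.1 ⊆ a.1 ∧ τ.1 ⊆ b.1) ρ ρ'
  oriented : ∀ (τ : Cell R (m - 1)) (ρ ρ' : Cell R m), ρ ≠ ρ' → τ.1 ⊆ ρ.1 → τ.1 ⊆ ρ'.1 →
    o.inc ρ.1 τ.1 = -o.inc ρ'.1 τ.1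

/-- A degree-1 `V`-error sub-pseudo-manifold: a simplicial immersion from a finite connected
oriented `k`-pseudo-manifold to `T`. A simplicial map is locally injective exactly if it is
injective on the vertices of the closed star of every vertex. -/
structure VError {V : Type u} (T : AbstractSimplicialComplex V) (k : ℕ) where
  W : Type u
  fin : Fintype W
  R : AbstractSimplicialComplex W
  or : Orientation W
  isPseudomanifold : IsOrientedPseudomanifold R or k
  map : W → V
  simplicial : ∀ s ∈ R.faces, s.image map ∈ T.faces
  immersion : ∀ v : W, Set.InjOn map {w | ({v, w} : Finset W) ∈ R.faces}

attribute [instance] VError.fin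

namespace VError

variable {V : Type u} {T : AbstractSimplicialComplex V} {k : ℕ} (E : VError T k)

theorem card_image {s : Finset E.W} (hs : s ∈ E.R.faces) :
    (s.image E.map).card = s.card := by
  apply Finset.card_image_of_injOn
  intro a ha b hb hab
  have sub : ∀ x ∈ s, ({a, x} : Finset E.W) ∈ E.R.faces := fun x hx =>
    (E.R.isRelLowerSet_faces hs).2
      (by intro y hy; simp only [Finset.mem_insert, Finset.mem_singleton] at hy
          rcases hy with rfl | rfl <;> simp_all) ⟨a, by simp⟩
  exact E.immersion a (sub a ha) (sub b hb) hab

/-- The image `f(s)` of a cell. -/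
def cell {j : ℤ} (s : Cell E.R j) : Cell T j :=
  ⟨s.1.image E.map, E.simplicial _ s.2.1, by rw [E.card_image s.2.1]; exact s.2.2⟩

/-- The sign `O(f(s), s)`. -/
def sign (o : Orientation V) {j : ℤ} (s : Cell E.R j) : ℤˣ := relSign E.or o E.map s.1

/-- The number of `k`-cells that lie over `β`. -/
def count (β : Cell T k) : ℕ := {ρ : Cell E.R k | E.cell ρ = β}.ncard

/-- The chain `∑ O(f(ρ), ρ) f(ρ)` associated with the image. -/
def chain (o : Orientation V) (β : Cell T k) : ℤ :=
  ∑ ρ : Cell E.R k, if E.cell ρ = β then (E.sign o ρ : ℤ) else 0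

/-- The error operator `∏ X_{f(ρ)} ^ O(f(ρ), ρ)`. -/
def operator [Fintype V] (o : Orientation V) (d : ℕ) : State T k d ≃ₗ[ℂ] State T k d :=
  prodX E.cell fun ρ => (E.sign o ρ : ℤ)

/-- `τ` is a boundary cell of the pseudo-manifold: it lies in exactly one `k`-cell. -/
def IsBoundary (τ : Cell E.R (k - 1)) : Prop := ∃! ρ : Cell E.R k, τ.1 ⊆ ρ.1

/-- The image under `f` of the oriented boundary of the pseudo-manifold, as a chain. -/
def boundaryChain (o : Orientation V) (α : Cell T (k - 1)) : ℤ :=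
  ∑ τ : Cell E.R (k - 1), if E.IsBoundary τ ∧ E.cell τ = α then
    (E.sign o τ : ℤ) * ∑ ρ : Cell E.R k, E.or.inc ρ.1 τ.1 else 0

/-- `E` is maximally connected among the error cells that are available: `avail β` degree-1 errors
on `β`, each with orientation `u β`. It can neither be enlarged by stitching more of them to its
boundary, nor can parts of its boundary be stitched together: every orientation-respecting map over
`T`, injective on `k`-cells, to another `V`-error sub-pseudo-manifold made of available error cells
is an isomorphism. -/
def IsMaximalIn (o : Orientation V) (avail : Cell T k → ℕ) (u : Cell T k → ℤˣ) : Prop :=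
  ∀ E' : VError T k, (∀ β, E'.count β ≤ avail β) → (∀ ρ : Cell E'.R k, E'.sign o ρ = u (E'.cell ρ)) →
    ∀ g : E.W → E'.W, (∀ s ∈ E.R.faces, s.image g ∈ E'.R.faces) → (∀ w, E'.map (g w) = E.map w) →
      (∀ ρ ρ' : Cell E.R k, ρ.1.image g = ρ'.1.image g → ρ = ρ') →
      Function.Bijective g ∧ ∀ s' ∈ E'.R.faces, ∃ s ∈ E.R.faces, s.image g = s'

end VError

/-! ### The closed dual and `P`-error sub-cellulations -/

/-- A finite regular cell complex, described by the poset of its cells (`x ≤ y` if `x` lies in the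
closed cell `y`) and their dimensions. -/
structure CellComplex where
  Cell : Type u
  fin : Fintype Cell
  order : PartialOrder Cell
  dim : Cell → ℤ
  dim_lt : ∀ x y, x < y → dim x < dim y
  dim_covBy : ∀ x y, x ⋖ y → dim y = dim x + 1

attribute [instance] CellComplex.fin CellComplex.order

section Dual

variable {V : Type u}

/-- The faces of the boundary subcomplex `∂T` of an `n`-dimensional complex: the faces of the
`(n-1)`-simplices that lie in exactly one `n`-simplex. -/
def boundaryFaces (T : AbstractSimplicialComplex V) (n : ℕ) : Set (Finset V) :=
  {s | s ∈ T.faces ∧ ∃ t : Cell T (n - 1), s ⊆ t.1 ∧ ∃! r : Cell T n, t.1 ⊆ r.1}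

/-- The cells of the closed dual `cl(T̂) = T̂ ∪ ∂T̂`: a cell of `T̂` for every simplex of `T`, and
(with `onBdry = true`) a cell of `∂T̂` for every simplex of `∂T`. -/
@[ext]
structure DualCell (T : AbstractSimplicialComplex V) (n : ℕ) where
  simplex : Finset V
  mem : simplex ∈ T.faces
  onBdry : Bool
  mem_bdry : onBdry = true → simplex ∈ boundaryFaces T n

namespace DualCell

variable {T : AbstractSimplicialComplex V} {n : ℕ}

/-- Duality reverses inclusions; the cell of `∂T̂` dual to a simplex `s` of `∂T` is pasted to the
boundary of the cell of `T̂` dual to `s`. -/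
instance : PartialOrder (DualCell T n) where
  le x y := y.simplex ⊆ x.simplex ∧ (y.onBdry = true → x.onBdry = true)
  le_refl x := ⟨subset_rfl, id⟩
  le_trans x y z h h' := ⟨h'.1.trans h.1, fun hz => h.2 (h'.2 hz)⟩
  le_antisymm x y h h' := by
    ext1
    · exact subset_antisymm h'.1 h.1
    · exact Bool.eq_iff_iff.mpr ⟨h'.2, h.2⟩

instance [Fintype V] : Fintype (DualCell T n) :=
  Fintype.ofInjective (fun x : DualCell T n => (x.simplex, x.onBdry)) (by
    intro x y h
    simp only [Prod.mk.injEq] at h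
    exact DualCell.ext h.1 h.2)

/-- A `j`-simplex has a dual cell of dimension `n - j` in `T̂` and, if it lies in `∂T`, one of
dimension `n - 1 - j` in `∂T̂`. -/
def dim (x : DualCell T n) : ℤ := (n : ℤ) + 1 - x.simplex.card - (if x.onBdry then 1 else 0)

theorem dim_lt {x y : DualCell T n} (h : x < y) : x.dim < y.dim := by
  obtain ⟨⟨h1, h2⟩, h3⟩ := lt_iff_le_not_ge.mp h
  have hc := Finset.card_le_card h1
  unfold dim
  rcases h1.eq_or_ssubset with he | hs
  · have : ¬ (x.onBdry = true → y.onBdry = true) := fun h' => h3 ⟨he.symm.subset, h'⟩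
    push Not at this
    rw [he]
    simp [this.1, this.2]
  · have := Finset.card_lt_card hs
    split_ifs with hx hy hy <;> first | omega | (exact absurd (h2 hy) hx)

theorem dim_covBy {x y : DualCell T n} (h : x ⋖ y) : y.dim = x.dim + 1 := by
  obtain ⟨⟨h1, h2⟩, h3⟩ := lt_iff_le_not_ge.mp h.1
  rcases h1.eq_or_ssubset with he | hs
  · have : ¬ (x.onBdry = true → y.onBdry = true) := fun h' => h3 ⟨he.symm.subset, h'⟩
    push Not at this
    unfold dim
    rw [he]
    simp [this.1, this.2]
  · -- the intermediate cell: remove one vertex from the simplex of `x`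
    obtain ⟨a, hax, hay⟩ := Finset.exists_of_ssubset hs
    have hsub : y.simplex ⊆ x.simplex.erase a := fun b hb =>
      Finset.mem_erase.mpr ⟨fun e => hay (e ▸ hb), h1 hb⟩
    have hne : (x.simplex.erase a).Nonempty :=
      (T.isRelLowerSet_faces y.mem).1.mono hsub
    have hmem : x.simplex.erase a ∈ T.faces :=
      (T.isRelLowerSet_faces x.mem).2 (Finset.erase_subset _ _) hne
    let z : DualCell T n := ⟨x.simplex.erase a, hmem, x.onBdry, fun hb => ⟨hmem, by
      obtain ⟨_, t, ht, hr⟩ := x.mem_bdry hb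
      exact ⟨t, (Finset.erase_subset _ _).trans ht, hr⟩⟩⟩
    have hxz : x < z := lt_iff_le_not_ge.mpr
      ⟨⟨Finset.erase_subset _ _, id⟩, fun h' => Finset.notMem_erase a _ (h'.1 hax)⟩
    have hzy : z ≤ y := ⟨hsub, h2⟩
    have : z = y := by
      by_contra hne'
      exact h.2 hxz (lt_of_le_of_ne hzy hne')
    rw [← this]
    have hcard := Finset.card_erase_add_one hax
    show (n : ℤ) + 1 - (x.simplex.erase a).card - (if x.onBdry then 1 else 0)
      = (n : ℤ) + 1 - x.simplex.card - (if x.onBdry then 1 else 0) + 1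
    omega

/-- The incidence numbers of the closed dual: `Ô(β̂, γ̂) = O(γ, β)` in `T̂`. The cell of `∂T̂` dual
to a simplex `s` of `∂T` carries the orientation induced from the cell of `T̂` dual to `s`. -/
def inc (o : Orientation V) (x y : DualCell T n) : ℤ :=
  match x.onBdry, y.onBdry with
  | false, false => o.inc y.simplex x.simplex
  | true, true => -o.inc y.simplex x.simplex
  | false, true => if x.simplex = y.simplex then 1 else 0
  | true, false => 0

/-- The cell `β̂` of `T̂` dual to the cell `β` of `T`. -/
def ofCell {j : ℤ} (β : Cell T j) : DualCell T n := ⟨β.1, β.2.1, false, by simp⟩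

end DualCell

/-- The closed dual `cl(T̂)` as a cell complex. For a triangulated `n`-manifold with boundary its
closed cells are the dual blocks of the simplices of `T` and of `∂T`. -/
def closedDual [Fintype V] (T : AbstractSimplicialComplex V) (n : ℕ) : CellComplex where
  Cell := DualCell T n
  fin := inferInstance
  order := inferInstance
  dim := DualCell.dim
  dim_lt _ _ := DualCell.dim_lt
  dim_covBy _ _ := DualCell.dim_covBy

end Dual

/-- A degree-1 `P`-error sub-cellulation: an immersion from a finite connected oriented
`(n-k)`-dimensional cell complex `R` (with the structure of a pseudo-manifold with boundary) to
`cl(T̂)`, taking `(n-k)`-cells to `(n-k)`-cells of `T̂`.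

The immersion maps cells to cells of the same dimension; `map_mono` and `map_lift` say that it maps
every closed cell of `R` isomorphically onto a closed cell of `cl(T̂)` (in particular `R` is a
regular CW complex if `cl(T̂)` is one), and `immersion` says that it is injective on the open star
of every cell, i.e. locally injective. An orientation of an `(n-k)`-cell `ρ` of `R` is the same as
an orientation of `f(ρ)`, and is recorded by the sign `sign ρ = O(f(ρ), ρ)`. -/
structure PError {V : Type u} [Fintype V] (T : AbstractSimplicialComplex V) (o : Orientation V)
    (n k : ℕ) where
  R : CellComplex.{u}
  map : R.Cell → DualCell T n
  map_dim : ∀ x, (map x).dim = R.dim x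
  map_mono : ∀ x y, x ≤ y → map x ≤ map y
  map_lift : ∀ (x : R.Cell) (c : DualCell T n), c ≤ map x → ∃! y, y ≤ x ∧ map y = c
  immersion : ∀ x : R.Cell, Set.InjOn map {y | x ≤ y}
  map_top : ∀ x, R.dim x = n - k → (map x).onBdry = false
  sign : {x : R.Cell // R.dim x = n - k} → ℤˣ
  nonempty : Nonempty {x : R.Cell // R.dim x = n - k}
  pure : ∀ x : R.Cell, ∃ ρ : {x : R.Cell // R.dim x = n - k}, x ≤ ρ
  one_or_two : ∀ τ : R.Cell, R.dim τ = n - k - 1 →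
    {ρ : {x : R.Cell // R.dim x = n - k} | τ ≤ ρ}.ncard = 1 ∨
    {ρ : {x : R.Cell // R.dim x = n - k} | τ ≤ ρ}.ncard = 2
  connected : ∀ ρ ρ' : {x : R.Cell // R.dim x = n - k},
    Relation.ReflTransGen (fun a b : {x : R.Cell // R.dim x = n - k} =>
      ∃ τ : R.Cell, R.dim τ = n - k - 1 ∧ τ ≤ a ∧ τ ≤ b) ρ ρ'
  oriented : ∀ τ : R.Cell, R.dim τ = n - k - 1 → ∀ ρ ρ' : {x : R.Cell // R.dim x = n - k},
    ρ ≠ ρ' → τ ≤ ρ → τ ≤ ρ' →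
    (sign ρ : ℤ) * DualCell.inc o (map ρ) (map τ) = -((sign ρ' : ℤ) * DualCell.inc o (map ρ') (map τ))

namespace PError

variable {V : Type u} [Fintype V] {T : AbstractSimplicialComplex V} {o : Orientation V} {n k : ℕ}
  (E : PError T o n k)

/-- The `(n-k)`-cells. -/
abbrev Top : Type u := {x : E.R.Cell // E.R.dim x = n - k}

/-- The `k`-cell of `T` whose dual is the image `f(ρ)` of an `(n-k)`-cell `ρ`. -/
def cell (ρ : E.Top) : Cell T k :=
  ⟨(E.map ρ.1).simplex, (E.map ρ.1).mem, by
    have h1 := E.map_dim ρ.1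
    have h2 := E.map_top ρ.1 ρ.2
    rw [ρ.2] at h1
    simp only [DualCell.dim, h2] at h1
    simp at h1
    omega⟩

/-- The number of `(n-k)`-cells that lie over the dual of `β`. -/
def count (β : Cell T k) : ℕ := {ρ : E.Top | E.cell ρ = β}.ncard

/-- The dual chain `ρ̂ = ∑ O(f(ρ), ρ) f(ρ)` associated with the image, written as a function on the
`k`-cells of `T`. -/
def chain (β : Cell T k) : ℤ := ∑ ρ : E.Top, if E.cell ρ = β then (E.sign ρ : ℤ) else 0

/-- The error operator `∏ Z ^ O(f(ρ), ρ)`, the factor of `ρ` acting on the dual of `f(ρ)`. -/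
def operator (d : ℕ) (ζ : Circle) : State T k d ≃ₗ[ℂ] State T k d :=
  prodZ ζ E.cell fun ρ => (E.sign ρ : ℤ)

/-- `τ` is a boundary cell: an `(n-k-1)`-cell that lies in exactly one `(n-k)`-cell. -/
def IsBoundary (τ : E.R.Cell) : Prop := E.R.dim τ = n - k - 1 ∧ ∃! ρ : E.Top, τ ≤ ρ

/-- The image of the oriented boundary of the cellulation as a chain in `T̂`, written as a function
on the `(k+1)`-cells of `T`. -/
def boundaryChain (γ : Cell T (k + 1)) : ℤ :=
  ∑ τ : E.R.Cell, if E.IsBoundary τ ∧ E.map τ = DualCell.ofCell γ then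
    ∑ ρ : E.Top, (if τ ≤ ρ then (E.sign ρ : ℤ) * DualCell.inc o (E.map ρ) (E.map τ) else 0) else 0

/-- `E` is maximally connected among the available error cells; see `VError.IsMaximalIn`. -/
def IsMaximalIn (avail : Cell T k → ℕ) (u : Cell T k → ℤˣ) : Prop :=
  ∀ E' : PError T o n k, (∀ β, E'.count β ≤ avail β) → (∀ ρ : E'.Top, E'.sign ρ = u (E'.cell ρ)) →
    ∀ g : E.R.Cell → E'.R.Cell, Monotone g → (∀ x, E'.map (g x) = E.map x) →
      (∀ ρ ρ' : E.Top, g ρ = g ρ' → ρ = ρ') → Function.Bijective g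

end PError

/-! ### Sets of errors and their decompositions -/

section Decomposition

variable {V : Type u} [Fintype V] {T : AbstractSimplicialComplex V} {n k : ℕ}

/-- Orientations `u` of `V`-errors of degrees `deg` are compatible: any two adjacent errors share an
orientation, i.e. a `(k-1)`-cell in their intersection agrees with one and disagrees with the
other. -/
def VCompatible (o : Orientation V) (deg : Cell T k → ℕ) (u : Cell T k → ℤˣ) : Prop :=
  ∀ (β β' : Cell T k) (α : Cell T (k - 1)), β ≠ β' → 0 < deg β → 0 < deg β' →
    α.1 ⊆ β.1 → α.1 ⊆ β'.1 → (u β : ℤ) * o.inc β.1 α.1 = -((u β' : ℤ) * o.inc β'.1 α.1)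

/-- The same for `P`-errors, in the dual: for two errors on `k`-cells `β`, `β'` whose dual cells
have the dual of the `(k+1)`-cell `γ` in common, it agrees with one and disagrees with the
other. -/
def PCompatible (o : Orientation V) (deg : Cell T k → ℕ) (u : Cell T k → ℤˣ) : Prop :=
  ∀ (β β' : Cell T k) (γ : Cell T (k + 1)), β ≠ β' → 0 < deg β → 0 < deg β' →
    β.1 ⊆ γ.1 → β'.1 ⊆ γ.1 → (u β : ℤ) * o.inc γ.1 β.1 = -((u β' : ℤ) * o.inc γ.1 β'.1)

/-- `R 0, R 1, …` is a decomposition of the `V`-errors of degrees `deg` and orientations `u` into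
maximally connected `V`-error sub-pseudo-manifolds: an error of degree `l` on `β` is used as `l`
degree-1 errors with the given orientation, and each piece is maximally connected among the errors
that are not used by earlier pieces. -/
def IsVDecomposition (o : Orientation V) (deg : Cell T k → ℕ) (u : Cell T k → ℤˣ) {N : ℕ}
    (R : Fin N → VError T k) : Prop :=
  (∀ β, ∑ j, (R j).count β = deg β) ∧
  (∀ j, ∀ ρ : Cell (R j).R k, (R j).sign o ρ = u ((R j).cell ρ)) ∧
  ∀ j, (R j).IsMaximalIn o (fun β => ∑ i ∈ Finset.Ici j, (R i).count β) u

/-- The analogous decomposition of `P`-errors into `P`-error sub-cellulations. -/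
def IsPDecomposition {o : Orientation V} (deg : Cell T k → ℕ) (u : Cell T k → ℤˣ) {N : ℕ}
    (S : Fin N → PError T o n k) : Prop :=
  (∀ β, ∑ j, (S j).count β = deg β) ∧
  (∀ j, ∀ ρ : (S j).Top, (S j).sign ρ = u ((S j).cell ρ)) ∧
  ∀ j, (S j).IsMaximalIn (fun β => ∑ i ∈ Finset.Ici j, (S i).count β) u

end Decomposition

end HomologyCode

end

noncomputable section

open Classical

namespace HomologyCode

/-! ### Incidence numbers -/

section Incidence

variable {V W : Type u}

/-! Every product of Pauli `X` operators is a translation `transl` of the group of `k`-chains over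
`ℤ/d`, and every product of `Z` operators is multiplication by a character, `phase`. So operators
depend only on their chains, and the lemma becomes homology. `V_α` is diagonal with eigenvalue `ζ ^
(∂c)_α` on `|c⟩`, and `P_γ` is translation by `∂γ`. Hence ground states are the functions supported
on cycles and invariant under boundaries. Translating by `a` makes `V_α` act as the scalar `ζ ^
(∂a)_α`; a phase by `b` makes `P_γ` act as `ζ ^ (-(∂̂b)_γ)`. As `ζ` has exact order `d`, such a
scalar is `1` only if the coefficient vanishes (`broken_stabV_iff`, `broken_stabP_iff`).

Two translations are compared on the sum of all boundaries, two phases on the sum of all cycles. In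
the second case the equations say that a cochain is orthogonal to all cycles, and duality of finite
abelian groups makes it a coboundary when `d ≠ 0`.

For one error piece, an immersion induces a chain map and interior facets cancel in pairs, so the
boundary of the image chain is the image of the boundary (`VError.boundary_chain`,
`PError.dualBoundary_chain`).

A decomposition is built greedily. A piece with as many top cells as possible and, among those, as
few vertices (or cells) as possible is maximally connected. If orientations are compatible, at most
two available cells meet along a facet, so a whole connected component of available cells is an
embedded piece; removing it lowers adjacent degrees equally. A boundary cell therefore appears over
a facet only if one adjacent degree differs from the other, or stands alone. The coefficient there
is then plus or minus a nonzero number of absolute value less than `d`, so it does not vanish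
(`exists_decomposition`, `intCast_sum_ne_zero_of_alternating`). -/

theorem enum_injective (s : Finset V) : Function.Injective (enum s) := fun i j h => by
  simpa [enum] using h

theorem image_enum (s : Finset V) : Finset.univ.image (enum s) = s := by
  ext x
  simp only [Finset.mem_image, Finset.mem_univ, true_and, enum]
  constructor
  · rintro ⟨i, rfl⟩
    exact (s.equivFin.symm i).2
  · exact fun hx => ⟨s.equivFin ⟨x, hx⟩, by simp⟩

theorem exists_perm_of_image_eq {m : ℕ} {v w : Fin m → V} (hv : Function.Injective v)
    (h : Finset.univ.image v = Finset.univ.image w) :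
    ∃ π : Equiv.Perm (Fin m), v = w ∘ π := by
  have key : ∀ i, ∃ j, w j = v i := fun i => by
    have : v i ∈ Finset.univ.image w := h ▸ Finset.mem_image_of_mem v (Finset.mem_univ i)
    simpa using this
  choose π hπ using key
  have hinj : Function.Injective π := fun i j hij => hv (by rw [← hπ i, ← hπ j, hij])
  exact ⟨Equiv.ofBijective π (Finite.injective_iff_bijective.mp hinj), funext fun i => (hπ i).symm⟩

theorem cons_injective {m : ℕ} {v : Fin m → V} (hv : Function.Injective v) {x : V}
    (hx : x ∉ Finset.univ.image v) : Function.Injective (Fin.cons x v : Fin (m + 1) → V) :=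
  Fin.cons_injective_iff.mpr ⟨by simpa using hx, hv⟩

theorem image_cons {m : ℕ} (v : Fin m → V) (x : V) :
    Finset.univ.image (Fin.cons x v : Fin (m + 1) → V) = insert x (Finset.univ.image v) := by
  ext y
  simp [Fin.exists_fin_succ, eq_comm]

/-- Fixing the first entry and permuting the tail by `π` is a permutation of the same sign as `π`.
-/
theorem Orientation.sgn_cons_comp (o : Orientation V) {m : ℕ} {v : Fin m → V}
    (hv : Function.Injective v) {x : V} (hx : x ∉ Finset.univ.image v)
    (π : Equiv.Perm (Fin m)) :
    o.sgn (Fin.cons x (v ∘ π) : Fin (m + 1) → V)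
      = Equiv.Perm.sign π * o.sgn (Fin.cons x v : Fin (m + 1) → V) := by
  have h : (Fin.cons x (v ∘ π) : Fin (m + 1) → V)
      = (Fin.cons x v : Fin (m + 1) → V) ∘ Equiv.Perm.decomposeFin.symm (0, π) := by
    funext i
    refine Fin.cases ?_ (fun i => ?_) i
    · simp
    · simp
  rw [h, o.alternating _ (cons_injective hv hx), Equiv.Perm.decomposeFin.symm_sign]
  simp

/-- Reordering multiplies both factors by the sign of the same permutation. This makes `relSign`
independent of the enumeration chosen by `enum`. -/
theorem Orientation.sgn_mul_sgn (oV : Orientation V) (oW : Orientation W) (f : W → V) {m : ℕ}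
    {v w : Fin m → W} (hv : Function.Injective v) (hw : Function.Injective w)
    (h : Finset.univ.image v = Finset.univ.image w) (hf : Set.InjOn f (Finset.univ.image w)) :
    oV.sgn (f ∘ v) * oW.sgn v = oV.sgn (f ∘ w) * oW.sgn w := by
  obtain ⟨π, rfl⟩ := exists_perm_of_image_eq hv h
  have hfw : Function.Injective (f ∘ w) := fun i j hij => hw (hf (by simp) (by simp) hij)
  rw [← Function.comp_assoc, oV.alternating _ hfw, oW.alternating _ hw, mul_mul_mul_comm,
    Int.units_mul_self, one_mul]

theorem relSign_eq (oW : Orientation W) (oV : Orientation V) {f : W → V} {s : Finset W} {m : ℕ}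
    {v : Fin m → W} (hv : Function.Injective v) (hs : Finset.univ.image v = s)
    (hf : Set.InjOn f s) : relSign oW oV f s = oV.sgn (f ∘ v) * oW.sgn v := by
  have hc : s.card = m := by
    rw [← hs, Finset.card_image_of_injective _ hv, Finset.card_univ, Fintype.card_fin]
  subst hc
  exact oV.sgn_mul_sgn oW f (enum_injective s) hv (by rw [image_enum, hs]) (by rwa [hs])

/-- Only the vertex `x` contributes to the sum, since deleting any other vertex leaves `x` in place.
Reordering `q` changes both signs alike, so any enumeration may be used. -/
theorem Orientation.inc_insert (o : Orientation V) {m : ℕ} {v : Fin m → V}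
    (hv : Function.Injective v) {q : Finset V} (hq : Finset.univ.image v = q) {x : V}
    (hx : x ∉ q) :
    o.inc (insert x q) q = ((o.sgn (Fin.cons x v : Fin (m + 1) → V) * o.sgn v : ℤˣ) : ℤ) := by
  have hc : q.card = m := by
    rw [← hq, Finset.card_image_of_injective _ hv, Finset.card_univ, Fintype.card_fin]
  subst hc
  unfold inc
  rw [Finset.sum_eq_single x]
  · rw [if_pos (Finset.erase_insert hx)]
    obtain ⟨π, rfl⟩ := exists_perm_of_image_eq (w := enum q) hv (by rw [image_enum, hq])
    have hx' : x ∉ Finset.univ.image (enum q) := by rwa [image_enum]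
    rw [o.sgn_cons_comp (enum_injective q) hx', o.alternating _ (enum_injective q),
      mul_mul_mul_comm, Int.units_mul_self, one_mul]
  · intro y hy hyx
    rw [if_neg]
    intro h
    have : x ∈ (insert x q).erase y := Finset.mem_erase.mpr ⟨hyx.symm, Finset.mem_insert_self x q⟩
    exact hx (h ▸ this)
  · exact fun h => absurd (Finset.mem_insert_self x q) h

theorem Orientation.exists_erase_of_inc_ne_zero (o : Orientation V) {p q : Finset V}
    (h : o.inc p q ≠ 0) : ∃ x ∈ p, p.erase x = q := by
  by_contra! hc
  exact h (Finset.sum_eq_zero fun x hx => if_neg (hc x hx))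

theorem Orientation.subset_of_inc_ne_zero (o : Orientation V) {p q : Finset V}
    (h : o.inc p q ≠ 0) : q ⊆ p := by
  obtain ⟨x, -, rfl⟩ := o.exists_erase_of_inc_ne_zero h
  exact Finset.erase_subset x p

theorem exists_erase_eq {p q : Finset V} (h : q ⊆ p) (hc : p.card = q.card + 1) :
    ∃ x ∈ p, p.erase x = q := by
  obtain ⟨x, hx, rfl⟩ := (Finset.covBy_iff_exists_insert.mp
    (Finset.covBy_iff_card_sdiff_eq_one.mpr ⟨h, by rw [Finset.card_sdiff_of_subset h]; omega⟩))
  exact ⟨x, Finset.mem_insert_self x q, Finset.erase_insert hx⟩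

theorem Orientation.exists_unit_inc (o : Orientation V) {p q : Finset V} (h : q ⊆ p)
    (hc : p.card = q.card + 1) : ∃ s : ℤˣ, o.inc p q = s := by
  obtain ⟨x, hx, rfl⟩ := exists_erase_eq h hc
  have := o.inc_insert (enum_injective (p.erase x)) (image_enum _) (Finset.notMem_erase x p)
  rw [Finset.insert_erase hx] at this
  exact ⟨_, this⟩

/-- This is what makes an immersion a chain map. In the enumeration that puts `x` before those of
`p.erase x`, the orientation signs of the domain each occur twice on the right and cancel. -/
theorem Orientation.inc_image (oW : Orientation W) (oV : Orientation V) {f : W → V}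
    {p : Finset W} (hf : Set.InjOn f p) {x : W} (hx : x ∈ p) :
    oV.inc (p.image f) ((p.erase x).image f)
      = relSign oW oV f p * relSign oW oV f (p.erase x) * oW.inc p (p.erase x) := by
  set q := p.erase x with hq
  have hxq : x ∉ q := Finset.notMem_erase x p
  have hp : p = insert x q := (Finset.insert_erase hx).symm
  have hfq : Set.InjOn f q := hf.mono (by simp [hq])
  have hinj := cons_injective (enum_injective q) (x := x) (by rwa [image_enum])
  have himg : Finset.univ.image (Fin.cons x (enum q) : Fin (q.card + 1) → W) = p := by
    rw [image_cons, image_enum, hp]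
  have hfx : f x ∉ q.image f := by
    intro h
    obtain ⟨y, hy, hyx⟩ := Finset.mem_image.mp h
    have : y = x := hf (by rw [hp]; simp [hy]) hx hyx
    exact hxq (this ▸ hy)
  have hfe : Function.Injective (f ∘ enum q) := fun i j hij => enum_injective q
    (hfq (by simp [enum]) (by simp [enum]) hij)
  have hcomp : f ∘ (Fin.cons x (enum q) : Fin (q.card + 1) → W)
      = (Fin.cons (f x) (f ∘ enum q) : Fin (q.card + 1) → V) := by
    funext i
    refine Fin.cases rfl (fun i => rfl) i
  rw [relSign_eq oW oV hinj himg hf, relSign_eq oW oV (enum_injective q) (image_enum q) hfq, hp,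
    Finset.image_insert, oV.inc_insert hfe (by rw [← Finset.image_image, image_enum]) hfx,
    oW.inc_insert (enum_injective q) (image_enum q) hxq, hcomp]
  norm_cast
  have a := Int.units_mul_self (oW.sgn (Fin.cons x (enum q) : Fin (q.card + 1) → W))
  have b := Int.units_mul_self (oW.sgn (enum q))
  generalize oW.sgn (Fin.cons x (enum q) : Fin (q.card + 1) → W) = s at *
  generalize oW.sgn (enum q) = t at *
  rcases Int.units_eq_one_or s with rfl | rfl <;> rcases Int.units_eq_one_or t with rfl | rfl <;>
    simp

/-- The two ways to remove two vertices from a simplex contribute opposite signs. -/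
theorem Orientation.inc_mul_inc_swap (o : Orientation V) {p : Finset V} {x y : V} (hx : x ∈ p)
    (hy : y ∈ p) (hxy : x ≠ y) :
    o.inc p (p.erase x) * o.inc (p.erase x) ((p.erase x).erase y)
      = -(o.inc p (p.erase y) * o.inc (p.erase y) ((p.erase y).erase x)) := by
  set q := (p.erase x).erase y with hq
  have hq' : (p.erase y).erase x = q := by rw [hq, Finset.erase_right_comm]
  -- The sign of the enumeration `b, q` of the intermediate face occurs in both incidence numbers
  -- and cancels. Only the order of the two removed vertices remains, and exchanging them is a
  -- transposition.
  have key : ∀ a b : V, a ∈ p → b ∈ p → a ≠ b → (p.erase a).erase b = q →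
      o.inc p (p.erase a) * o.inc (p.erase a) q
        = ((o.sgn (Fin.cons a (Fin.cons b (enum q) : Fin (q.card + 1) → V) : Fin (q.card + 2) → V)
          * o.sgn (enum q) : ℤˣ) : ℤ) := by
    intro a b ha hb hab h
    have hbq : b ∉ q := h ▸ Finset.notMem_erase _ _
    have hbe : b ∈ p.erase a := Finset.mem_erase.mpr ⟨hab.symm, hb⟩
    have hpa : p.erase a = insert b q := by rw [← h, Finset.insert_erase hbe]
    have hab' : a ∉ insert b q := hpa ▸ Finset.notMem_erase a p
    have hp : p = insert a (insert b q) := by rw [← hpa, Finset.insert_erase ha]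
    have h1 := cons_injective (enum_injective q) (x := b) (by rwa [image_enum])
    rw [hpa, o.inc_insert (enum_injective q) (image_enum q) hbq]
    conv_lhs => rw [hp]
    rw [o.inc_insert h1 (by rw [image_cons, image_enum]) hab']
    norm_cast
    rw [mul_assoc, ← mul_assoc (o.sgn (Fin.cons b _ : Fin (q.card + 1) → V)), Int.units_mul_self,
      one_mul]
  rw [hq', key x y hx hy hxy hq.symm, key y x hy hx hxy.symm hq']
  have hswap : (Fin.cons x (Fin.cons y (enum q) : Fin (q.card + 1) → V) : Fin (q.card + 2) → V)
      = (Fin.cons y (Fin.cons x (enum q) : Fin (q.card + 1) → V) : Fin (q.card + 2) → V)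
        ∘ Equiv.swap 0 1 := by
    funext i
    refine Fin.cases ?_ (fun i => ?_) i
    · simp
    · refine Fin.cases ?_ (fun i => ?_) i
      · simp
      · have h0 : (i.succ.succ : Fin (q.card + 2)) ≠ 0 := Fin.succ_ne_zero _
        have h1 : (i.succ.succ : Fin (q.card + 2)) ≠ 1 := fun h =>
          Fin.succ_ne_zero i (Fin.succ_injective _ h)
        simp [Equiv.swap_apply_of_ne_of_ne h0 h1]
  have hinj : Function.Injective
      (Fin.cons y (Fin.cons x (enum q) : Fin (q.card + 1) → V) : Fin (q.card + 2) → V) := by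
    refine cons_injective (cons_injective (enum_injective q) ?_) ?_
    · rw [image_enum, ← hq']; exact Finset.notMem_erase _ _
    · rw [image_cons, image_enum, ← hq',
        Finset.insert_erase (Finset.mem_erase.mpr ⟨hxy, hx⟩)]
      exact Finset.notMem_erase _ _
  rw [hswap, o.alternating _ hinj, Equiv.Perm.sign_swap (by simp)]
  simp

variable [Fintype V] {T : AbstractSimplicialComplex V}

/-- The boundary of a boundary vanishes. -/
theorem Orientation.sum_inc_mul_inc (o : Orientation V) {k : ℕ} (γ : Cell T (k + 1))
    (α : Cell T (k - 1)) : ∑ β : Cell T k, o.inc γ.1 β.1 * o.inc β.1 α.1 = 0 := by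
  have hγ : γ.1.card = k + 2 := by have := γ.2.2; omega
  have hface : ∀ x ∈ γ.1, γ.1.erase x ∈ T.faces := fun x hx =>
    (T.isRelLowerSet_faces γ.2.1).2 (Finset.erase_subset x _)
      (Finset.card_pos.mp (by rw [Finset.card_erase_of_mem hx]; omega))
  -- The faces of `γ` are indexed by the removed vertex.
  have step : ∑ β : Cell T k, o.inc γ.1 β.1 * o.inc β.1 α.1
      = ∑ x ∈ γ.1, o.inc γ.1 (γ.1.erase x) * o.inc (γ.1.erase x) α.1 := by
    rw [← Finset.sum_coe_sort γ.1]
    symm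
    refine Finset.sum_bij_ne_zero (fun x _ _ => ⟨γ.1.erase x.1, hface x.1 x.2, by
      rw [Finset.card_erase_of_mem x.2]; omega⟩) (fun _ _ _ => Finset.mem_univ _) ?_ ?_ ?_
    · intro x _ _ y _ _ h
      have h' := congrArg Subtype.val h
      exact Subtype.ext (Finset.erase_injOn γ.1 x.2 y.2 h')
    · intro β _ hβ
      obtain ⟨x, hx, hxβ⟩ := o.exists_erase_of_inc_ne_zero (left_ne_zero_of_mul hβ)
      refine ⟨⟨x, hx⟩, Finset.mem_univ _, ?_, Subtype.ext hxβ⟩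
      simpa only [hxβ] using hβ
    · intros; rfl
  -- Recording the second removed vertex as well gives a sum over ordered pairs of distinct
  -- vertices, which is antisymmetric under exchange of the two.
  have expand : ∀ x ∈ γ.1, o.inc γ.1 (γ.1.erase x) * o.inc (γ.1.erase x) α.1
      = ∑ y ∈ γ.1, if x ≠ y ∧ (γ.1.erase x).erase y = α.1 then
          o.inc γ.1 (γ.1.erase x) * o.inc (γ.1.erase x) ((γ.1.erase x).erase y) else 0 := by
    intro x hx
    by_cases h : ∃ y ∈ γ.1.erase x, (γ.1.erase x).erase y = α.1
    · obtain ⟨y, hy, hyα⟩ := h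
      obtain ⟨hyx, hyγ⟩ := Finset.mem_erase.mp hy
      rw [Finset.sum_eq_single y, if_pos ⟨hyx.symm, hyα⟩, hyα]
      · intro z hz hzy
        rw [if_neg]
        rintro ⟨hxz, hzα⟩
        exact hzy (Finset.erase_injOn (γ.1.erase x) (Finset.mem_erase.mpr ⟨hxz.symm, hz⟩) hy
          (hzα.trans hyα.symm))
      · exact fun h => absurd hyγ h
    · have h0 : o.inc (γ.1.erase x) α.1 = 0 := by
        by_contra hne
        exact h (o.exists_erase_of_inc_ne_zero hne)
      rw [h0, mul_zero]
      refine (Finset.sum_eq_zero fun y hy => if_neg ?_).symm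
      rintro ⟨hxy, hyα⟩
      exact h ⟨y, Finset.mem_erase.mpr ⟨hxy.symm, hy⟩, hyα⟩
  rw [step, Finset.sum_congr rfl expand]
  have anti : ∀ S : ℤ, S = -S → S = 0 := fun S h => by omega
  apply anti
  conv_lhs => rw [Finset.sum_comm]
  rw [← Finset.sum_neg_distrib]
  refine Finset.sum_congr rfl fun x hx => ?_
  rw [← Finset.sum_neg_distrib]
  refine Finset.sum_congr rfl fun y hy => ?_
  have hc : (x ≠ y ∧ (γ.1.erase x).erase y = α.1) ↔ (y ≠ x ∧ (γ.1.erase y).erase x = α.1) := by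
    rw [Finset.erase_right_comm, ne_comm]
  simp only [hc]
  split_ifs with h
  · exact o.inc_mul_inc_swap hy hx h.1
  · simp

end Incidence

/-! ### Error operators as translations and phases -/

section Operators

variable {d : ℕ}

/-- The integer representative of `m` modulo `d` differs from `m` by a multiple of `d`, which `ζ`
does not see. -/
theorem zpow_cast_intCast {ζ : Circle} (hζ : ζ ^ d = 1) (m : ℤ) :
    (ζ : ℂ) ^ ((m : ZMod d).cast : ℤ) = (ζ : ℂ) ^ m := by
  have h1 : (((((m : ZMod d).cast : ℤ)) : ℤ) : ZMod d) = (m : ZMod d) := by simp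
  obtain ⟨e, he⟩ := (ZMod.intCast_eq_intCast_iff_dvd_sub _ _ d).mp h1
  have hz : (ζ : ℂ) ^ (d : ℤ) = 1 := by exact_mod_cast congrArg (Subtype.val) hζ
  have : m = ((m : ZMod d).cast : ℤ) + d * e := by omega
  conv_rhs => rw [this, zpow_add₀ (Circle.coe_ne_zero ζ), zpow_mul, hz, one_zpow, mul_one]

/-- The additive character `x ↦ ζ ^ x` of `ℤ/d`. -/
def zetaChar (ζ : Circle) (hζ : ζ ^ d = 1) : AddChar (ZMod d) ℂ where
  toFun x := (ζ : ℂ) ^ (x.cast : ℤ)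
  map_zero_eq_one' := by simp
  map_add_eq_mul' x y := by
    obtain ⟨a, rfl⟩ := ZMod.intCast_surjective x
    obtain ⟨b, rfl⟩ := ZMod.intCast_surjective y
    rw [← Int.cast_add, zpow_cast_intCast hζ, zpow_cast_intCast hζ, zpow_cast_intCast hζ,
      zpow_add₀ (Circle.coe_ne_zero ζ)]

theorem zetaChar_apply (ζ : Circle) (hζ : ζ ^ d = 1) (x : ZMod d) :
    zetaChar ζ hζ x = (ζ : ℂ) ^ (x.cast : ℤ) := rfl

/-- Here the exactness of the order of `ζ` enters: the character is faithful. For `d = 0` this is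
infinite order. -/
theorem zetaChar_eq_one_iff {ζ : Circle} (hζ : IsPrimitiveRoot ζ d) (x : ZMod d) :
    zetaChar ζ hζ.pow_eq_one x = 1 ↔ x = 0 := by
  obtain ⟨a, rfl⟩ := ZMod.intCast_surjective x
  rw [zetaChar_apply, zpow_cast_intCast hζ.pow_eq_one, ZMod.intCast_zmod_eq_zero_iff_dvd,
    ← hζ.zpow_eq_one_iff_dvd]
  exact_mod_cast Circle.coe_inj (x := ζ ^ a) (y := 1)

theorem zetaChar_ne_zero (ζ : Circle) (hζ : ζ ^ d = 1) (x : ZMod d) : zetaChar ζ hζ x ≠ 0 :=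
  zpow_ne_zero _ (Circle.coe_ne_zero ζ)

/-- Pauli operators of one type lie in the image of a commutative group of chains, where their
product is an ordinary one. -/
theorem noncommProd_map {ι M N : Type*} [CommMonoid M] [Monoid N] (φ : M →* N) (s : Finset ι)
    (f : ι → M) : s.noncommProd (fun i => φ (f i)) (fun i _ j _ _ => (Commute.all (f i) (f j)).map φ)
      = φ (∏ i ∈ s, f i) := by
  rw [← Finset.noncommProd_eq_prod]
  exact (Finset.map_noncommProd s f _ φ).symm

variable {V : Type u} {T : AbstractSimplicialComplex V} {k : ℤ}

/-- The pairing of chains and cochains. -/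
def pair [Fintype V] (a c : Cell T k → ZMod d) : ZMod d := ∑ β, a β * c β

section pair

variable [Fintype V]

theorem pair_add_left (a b c : Cell T k → ZMod d) : pair (a + b) c = pair a c + pair b c := by
  simp [pair, add_mul, Finset.sum_add_distrib]

theorem pair_sub_left (a b c : Cell T k → ZMod d) : pair (a - b) c = pair a c - pair b c := by
  simp [pair, sub_mul, Finset.sum_sub_distrib]

theorem pair_sub_right (a b c : Cell T k → ZMod d) : pair a (b - c) = pair a b - pair a c := by
  simp [pair, mul_sub, Finset.sum_sub_distrib]

theorem pair_single_left (β : Cell T k) (x : ZMod d) (c : Cell T k → ZMod d) :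
    pair (Pi.single β x) c = x * c β := by
  rw [pair, Finset.sum_eq_single β]
  · simp
  · intro b _ hb; simp [hb]
  · simp

end pair

variable (d T k) in
/-- The translations `|c⟩ ↦ |c + a⟩`. -/
def transl : Multiplicative (Cell T k → ZMod d) →* (State T k d ≃ₗ[ℂ] State T k d) where
  toFun a :=
    { toFun := fun ψ c => ψ (c - a.toAdd)
      invFun := fun ψ c => ψ (c + a.toAdd)
      map_add' := fun _ _ => rfl
      map_smul' := fun _ _ => rfl
      left_inv := fun ψ => by funext c; simp
      right_inv := fun ψ => by funext c; simp }
  map_one' := by ext ψ c; simp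
  map_mul' a b := by
    ext ψ c
    simp only [LinearEquiv.coe_mk, LinearMap.coe_mk, AddHom.coe_mk, toAdd_mul,
      LinearEquiv.mul_apply]
    rw [sub_sub]

theorem transl_apply (a c : Cell T k → ZMod d) (ψ : State T k d) :
    transl d T k (.ofAdd a) ψ c = ψ (c - a) := rfl

theorem pauliX_eq_transl (β : Cell T k) :
    pauliX (d := d) β = transl d T k (.ofAdd (Pi.single β 1)) := rfl

/-- Since `transl` is a homomorphism, only the total exponent over each cell matters. -/
theorem prodX_eq_transl {ι : Type u} [Fintype ι] (cell : ι → Cell T k) (e : ι → ℤ) :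
    prodX (d := d) cell e
      = transl d T k (.ofAdd fun β => ((∑ i, if cell i = β then e i else 0 : ℤ) : ZMod d)) := by
  have h : (fun β => ((∑ i, if cell i = β then e i else 0 : ℤ) : ZMod d))
      = ∑ i, e i • (Pi.single (cell i) 1 : Cell T k → ZMod d) := by
    funext β
    simp [Finset.sum_apply, Pi.single_apply, eq_comm]
  rw [h, ofAdd_sum, ← noncommProd_map]
  refine Finset.noncommProd_congr rfl (fun i _ => ?_) _
  rw [pauliX_eq_transl, ← map_zpow, ofAdd_zsmul]

variable [Fintype V]

variable (T k) in
/-- The diagonal operators `|c⟩ ↦ ζ ^ ⟨a, c⟩ |c⟩`. -/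
def phase (ζ : Circle) (hζ : ζ ^ d = 1) :
    Multiplicative (Cell T k → ZMod d) →* (State T k d ≃ₗ[ℂ] State T k d) where
  toFun a :=
    { toFun := fun ψ c => zetaChar ζ hζ (pair a.toAdd c) * ψ c
      invFun := fun ψ c => zetaChar ζ hζ (-pair a.toAdd c) * ψ c
      map_add' := fun _ _ => by funext c; simp [mul_add]
      map_smul' := fun _ _ => by funext c; simp; ring
      left_inv := fun ψ => by
        funext c
        beta_reduce
        rw [← mul_assoc, ← AddChar.map_add_eq_mul, neg_add_cancel, AddChar.map_zero_eq_one,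
          one_mul]
      right_inv := fun ψ => by
        funext c
        beta_reduce
        rw [← mul_assoc, ← AddChar.map_add_eq_mul, add_neg_cancel, AddChar.map_zero_eq_one,
          one_mul] }
  map_one' := by ext ψ c; simp [pair]
  map_mul' a b := by
    ext ψ c
    simp only [LinearEquiv.coe_mk, LinearMap.coe_mk, AddHom.coe_mk, toAdd_mul,
      LinearEquiv.mul_apply]
    rw [pair_add_left, AddChar.map_add_eq_mul, mul_assoc]

theorem phase_apply {ζ : Circle} (hζ : ζ ^ d = 1) (a c : Cell T k → ZMod d)
    (ψ : State T k d) :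
    phase T k ζ hζ (.ofAdd a) ψ c = zetaChar ζ hζ (pair a c) * ψ c := rfl

theorem pauliZ_eq_phase {ζ : Circle} (hζ : ζ ^ d = 1) (β : Cell T k) :
    pauliZ (d := d) ζ β = phase T k ζ hζ (.ofAdd (Pi.single β 1)) := by
  ext ψ c
  rw [phase_apply, pair_single_left, one_mul]
  rfl

theorem prodZ_eq_phase {ζ : Circle} (hζ : ζ ^ d = 1) {ι : Type u} [Fintype ι]
    (cell : ι → Cell T k) (e : ι → ℤ) :
    prodZ (d := d) ζ cell e
      = phase T k ζ hζ
        (.ofAdd fun β => ((∑ i, if cell i = β then e i else 0 : ℤ) : ZMod d)) := by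
  have h : (fun β => ((∑ i, if cell i = β then e i else 0 : ℤ) : ZMod d))
      = ∑ i, e i • (Pi.single (cell i) 1 : Cell T k → ZMod d) := by
    funext β
    simp [Finset.sum_apply, Pi.single_apply, eq_comm]
  rw [h, ofAdd_sum, ← noncommProd_map]
  refine Finset.noncommProd_congr rfl (fun i _ => ?_) _
  rw [pauliZ_eq_phase hζ, ← map_zpow, ofAdd_zsmul]

theorem errorX_eq_transl (a : Cell T k → ℤ) :
    errorX (d := d) a = transl d T k (.ofAdd fun β => (a β : ZMod d)) := by
  rw [errorX, prodX_eq_transl]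
  simp

theorem errorZ_eq_phase {ζ : Circle} (hζ : ζ ^ d = 1) (a : Cell T k → ℤ) :
    errorZ (d := d) ζ a = phase T k ζ hζ (.ofAdd fun β => (a β : ZMod d)) := by
  rw [errorZ, prodZ_eq_phase hζ]
  simp

end Operators

/-! ### Ground states and broken stabilizers -/

section Ground

variable {V : Type u} [Fintype V] {T : AbstractSimplicialComplex V} {k : ℤ} {d : ℕ}
  (o : Orientation V) {ζ : Circle} (hζ : IsPrimitiveRoot ζ d)

theorem boundary_sub {i j : ℤ} (a b : Cell T i → ZMod d) (α : Cell T j) :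
    boundary o (a - b) α = boundary o a α - boundary o b α := by
  simp [boundary, mul_sub, Finset.sum_sub_distrib]

theorem boundary_add {i j : ℤ} (a b : Cell T i → ZMod d) (α : Cell T j) :
    boundary o (a + b) α = boundary o a α + boundary o b α := by
  simp [boundary, mul_add, Finset.sum_add_distrib]

theorem boundary_intCast {i j : ℤ} (a : Cell T i → ℤ) (α : Cell T j) :
    boundary o (fun β => (a β : ZMod d)) α = ((boundary o a α : ℤ) : ZMod d) := by
  simp [boundary]

theorem dualBoundary_intCast {i j : ℤ} (a : Cell T i → ℤ) (γ : Cell T j) :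
    dualBoundary o (fun β => (a β : ZMod d)) γ = ((dualBoundary o a γ : ℤ) : ZMod d) := by
  simp [dualBoundary]

theorem stabV_apply (α : Cell T (k - 1)) (ψ : State T k d) (c : Cell T k → ZMod d) :
    stabV o ζ α ψ c = zetaChar ζ hζ.pow_eq_one (boundary o c α) * ψ c := by
  rw [stabV, errorZ_eq_phase hζ.pow_eq_one, phase_apply]
  rfl

theorem stabP_eq_transl (γ : Cell T (k + 1)) :
    stabP (d := d) o γ = transl d T k (.ofAdd fun β => (o.inc γ.1 β.1 : ZMod d)) := by
  rw [stabP, errorX_eq_transl]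

-- `V_α` is diagonal, so wherever `ψ` is nonzero its eigenvalue must be `1`: ground states are
-- supported on cycles.
include hζ in
theorem boundary_eq_zero_of_mem_codeSpace {ψ : State T k d} (hψ : ψ ∈ codeSpace o ζ)
    {c : Cell T k → ZMod d} (hc : ψ c ≠ 0) (α : Cell T (k - 1)) : boundary o c α = 0 := by
  have h := congrFun (hψ.1 α) c
  rw [stabV_apply o hζ] at h
  exact (zetaChar_eq_one_iff hζ _).mp (mul_right_cancel₀ hc (h.trans (one_mul _).symm))

theorem apply_sub_of_mem_codeSpace {ψ : State T k d} (hψ : ψ ∈ codeSpace o ζ)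
    (c : Cell T k → ZMod d) (γ : Cell T (k + 1)) :
    ψ (c - fun β => (o.inc γ.1 β.1 : ZMod d)) = ψ c := by
  have h := congrFun (hψ.2 γ) c
  rwa [stabP_eq_transl, transl_apply] at h

theorem apply_sub_zsmul_of_invariant {A : Type*} [AddCommGroup A] {X : Type*} {ψ : A → X} {b : A}
    (h : ∀ c, ψ (c - b) = ψ c) (m : ℤ) (c : A) : ψ (c - m • b) = ψ c := by
  induction m generalizing c with
  | zero => simp
  | succ m ih =>
    have : c - ((m : ℤ) + 1) • b = (c - (m : ℤ) • b) - b := by rw [add_smul, one_smul, sub_sub]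
    rw [this, h, ih]
  | pred m ih =>
    have : c - (-(m : ℤ) - 1) • b = (c - (-(m : ℤ)) • b) + b := by
      rw [sub_smul, one_smul, sub_sub_eq_add_sub, add_sub_right_comm]
    rw [this, ← h, add_sub_cancel_right, ih]

/-- Being fixed by `P_γ` is invariance under translation by `∂γ`, and every boundary is an integral
combination of these. So a ground state is constant on homology classes. -/
theorem apply_sub_boundary_of_mem_codeSpace {ψ : State T k d} (hψ : ψ ∈ codeSpace o ζ)
    (c : Cell T k → ZMod d) (b : Cell T (k + 1) → ZMod d) :
    ψ (c - fun β => boundary o b β) = ψ c := by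
  have h : (fun β : Cell T k => boundary o b β)
      = ∑ γ : Cell T (k + 1), ((b γ).cast : ℤ) •
        (fun β => (o.inc γ.1 β.1 : ZMod d) : Cell T k → ZMod d) := by
    funext β
    simp only [boundary, Finset.sum_apply]
    refine Finset.sum_congr rfl fun γ _ => ?_
    rw [Pi.smul_apply, zsmul_eq_mul, ZMod.intCast_cast, ZMod.cast_id', id, mul_comm]
  rw [h]
  generalize (Finset.univ : Finset (Cell T (k + 1))) = s
  induction s using Finset.induction_on with
  | empty => simp
  | insert γ s hγ ih =>
    rw [Finset.sum_insert hγ, add_comm, ← sub_sub,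
      apply_sub_zsmul_of_invariant (fun c => apply_sub_of_mem_codeSpace o hψ c γ), ih]

include hζ in
/-- A stabilizer `V_α` is broken by a translation together with phases exactly if the translation
chain has nonzero boundary coefficient at `α`. -/
theorem broken_stabV_iff {ψ : State T k d} (hψ : ψ ∈ codeSpace o ζ) (h0 : ψ ≠ 0)
    (a b : Cell T k → ZMod d) (α : Cell T (k - 1)) :
    Broken (stabV o ζ α) (transl d T k (.ofAdd a) (phase T k ζ hζ.pow_eq_one (.ofAdd b) ψ)) ↔
      boundary o a α ≠ 0 := by
  -- The translated state lives on the chains `cycle + a`, all with the boundary of `a`; hence `V_α`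
  -- acts on it as one scalar. The phase does not change the support.
  have hb : ∀ c, ψ c ≠ 0 → boundary o (c + a) α = boundary o a α := fun c hc => by
    rw [boundary_add, boundary_eq_zero_of_mem_codeSpace o hζ hψ hc, zero_add]
  unfold Broken
  rw [not_iff_not]
  constructor
  · intro h
    obtain ⟨c, hc⟩ := Function.ne_iff.mp h0
    have h' := congrFun h (c + a)
    rw [stabV_apply o hζ, transl_apply, add_sub_cancel_right, phase_apply, hb c hc] at h'
    refine (zetaChar_eq_one_iff hζ _).mp (mul_right_cancel₀ ?_ (h'.trans (one_mul _).symm))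
    exact mul_ne_zero (zetaChar_ne_zero ζ _ _) hc
  · intro h
    funext c
    rw [stabV_apply o hζ, transl_apply, phase_apply]
    by_cases hc : ψ (c - a) = 0
    · rw [hc]; simp
    · have := hb _ hc
      rw [sub_add_cancel] at this
      rw [this, h, AddChar.map_zero_eq_one, one_mul]

include hζ in
/-- A stabilizer `P_γ` is broken by a translation together with phases exactly if the phase
cochain has nonzero dual boundary coefficient at `γ`. -/
theorem broken_stabP_iff {ψ : State T k d} (hψ : ψ ∈ codeSpace o ζ) (h0 : ψ ≠ 0)
    (a b : Cell T k → ZMod d) (γ : Cell T (k + 1)) :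
    Broken (stabP o γ) (transl d T k (.ofAdd a) (phase T k ζ hζ.pow_eq_one (.ofAdd b) ψ)) ↔
      dualBoundary o b γ ≠ 0 := by
  -- Translating by `∂γ` changes the phase by the pairing of `b` with `∂γ`, which is the coefficient
  -- of the dual boundary of `b` at `γ`. As `ψ` itself is invariant, `P_γ` acts as this scalar.
  have hp : ∀ c : Cell T k → ZMod d, zetaChar ζ hζ.pow_eq_one
        (pair b (c - fun β => (o.inc γ.1 β.1 : ZMod d)))
      = zetaChar ζ hζ.pow_eq_one (-dualBoundary o b γ) * zetaChar ζ hζ.pow_eq_one (pair b c) := by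
    intro c
    rw [← AddChar.map_add_eq_mul, pair_sub_right, neg_add_eq_sub]
    congr 2
    simp [pair, dualBoundary, mul_comm]
  unfold Broken
  rw [not_iff_not]
  constructor
  · intro h
    obtain ⟨c, hc⟩ := Function.ne_iff.mp h0
    have h' := congrFun h (c + a)
    rw [stabP_eq_transl, transl_apply, transl_apply, transl_apply, add_sub_cancel_right,
      sub_right_comm, add_sub_cancel_right, phase_apply, phase_apply, hp,
      apply_sub_of_mem_codeSpace o hψ, mul_assoc] at h'
    rw [← neg_eq_zero]
    refine (zetaChar_eq_one_iff hζ _).mp (mul_right_cancel₀ ?_ (h'.trans (one_mul _).symm))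
    exact mul_ne_zero (zetaChar_ne_zero ζ _ _) hc
  · intro h
    funext c
    rw [stabP_eq_transl, transl_apply, transl_apply, transl_apply, sub_right_comm, phase_apply,
      phase_apply, hp, apply_sub_of_mem_codeSpace o hψ, h, neg_zero, AddChar.map_zero_eq_one,
      one_mul]

end Ground

/-! ### Errors that act equally on the code space -/

section Equality

variable {V : Type u} [Fintype V] {T : AbstractSimplicialComplex V} {d : ℕ} (o : Orientation V)
  {ζ : Circle} (hζ : IsPrimitiveRoot ζ d)

theorem boundary_boundary {k : ℕ} (b : Cell T (k + 1) → ZMod d) (α : Cell T (k - 1)) :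
    boundary o (fun β : Cell T k => boundary o b β) α = 0 := by
  simp only [boundary, Finset.mul_sum]
  rw [Finset.sum_comm]
  refine Finset.sum_eq_zero fun γ _ => ?_
  have h := congrArg (Int.cast : ℤ → ZMod d) (o.sum_inc_mul_inc γ α)
  push_cast at h
  calc ∑ β : Cell T k, (o.inc β.1 α.1 : ZMod d) * ((o.inc γ.1 β.1 : ZMod d) * b γ)
      = (∑ β : Cell T k, (o.inc γ.1 β.1 : ZMod d) * (o.inc β.1 α.1 : ZMod d)) * b γ := by
        rw [Finset.sum_mul]
        exact Finset.sum_congr rfl fun β _ => by ring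
    _ = 0 := by rw [h, zero_mul]

/-- The dual boundary is the coboundary, the transpose of `boundary`: both sides are the same double
sum. -/
theorem pair_dualBoundary {i j : ℤ} (b : Cell T j → ZMod d) (c : Cell T i → ZMod d) :
    pair (fun β => dualBoundary o b β) c = pair b (fun α => boundary o c α) := by
  simp only [pair, dualBoundary, boundary, Finset.mul_sum, Finset.sum_mul]
  rw [Finset.sum_comm]
  exact Finset.sum_congr rfl fun _ _ => Finset.sum_congr rfl fun _ _ => by ring

variable (T d) in
/-- The sum of all basis states given by cycles. -/
def cycleState (k : ℤ) : State T k d := fun c =>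
  if ∀ α : Cell T (k - 1), boundary o c α = 0 then 1 else 0

variable (T d) in
/-- The sum of all basis states given by boundaries. -/
def boundaryState (k : ℤ) : State T k d := fun c =>
  if ∃ b : Cell T (k + 1) → ZMod d, ∀ β, c β = boundary o b β then 1 else 0

theorem boundary_single {i j : ℤ} (γ : Cell T i) (β : Cell T j) :
    boundary o (Pi.single γ (1 : ZMod d)) β = (o.inc γ.1 β.1 : ZMod d) := by
  rw [boundary, Finset.sum_eq_single γ]
  · simp
  · intro b _ hb; simp [hb]
  · simp

include hζ in
theorem cycleState_mem (k : ℕ) : cycleState T d o k ∈ codeSpace o ζ := by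
  constructor
  · intro α
    funext c
    rw [stabV_apply o hζ, cycleState]
    split_ifs with h
    · rw [h, AddChar.map_zero_eq_one, one_mul]
    · rw [mul_zero]
  · intro γ
    funext c
    rw [stabP_eq_transl, transl_apply, cycleState, cycleState]
    have h : ∀ α : Cell T (k - 1), boundary o (c - fun β => (o.inc γ.1 β.1 : ZMod d)) α
        = boundary o c α := fun α => by
      have := boundary_boundary o (Pi.single γ (1 : ZMod d)) α
      simp only [boundary_single] at this
      rw [boundary_sub, this, sub_zero]
    simp only [h]

include hζ in
theorem boundaryState_mem (k : ℕ) : boundaryState T d o k ∈ codeSpace o ζ := by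
  constructor
  · intro α
    funext c
    rw [stabV_apply o hζ, boundaryState]
    split_ifs with h
    · obtain ⟨b, hb⟩ := h
      obtain rfl : c = fun β => boundary o b β := funext hb
      rw [boundary_boundary, AddChar.map_zero_eq_one, one_mul]
    · rw [mul_zero]
  · intro γ
    funext c
    rw [stabP_eq_transl, transl_apply, boundaryState, boundaryState]
    congr 1
    refine propext ⟨fun ⟨b, hb⟩ => ⟨b + Pi.single γ 1, fun β => ?_⟩,
      fun ⟨b, hb⟩ => ⟨b - Pi.single γ 1, fun β => ?_⟩⟩
    · rw [boundary_add, ← hb, boundary_single]; simp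
    · rw [boundary_sub, ← hb, boundary_single]; simp

-- Ground states cannot see boundaries, and the indicator function of the boundaries is a ground
-- state that sees everything else.
include hζ in
theorem transl_eq_on_codeSpace_iff {k : ℕ} (a a' : Cell T k → ZMod d) :
    (∀ ψ ∈ codeSpace (T := T) (k := k) (d := d) o ζ,
      transl d T k (.ofAdd a) ψ = transl d T k (.ofAdd a') ψ) ↔
    ∃ b : Cell T (k + 1) → ZMod d, ∀ β, a β = a' β + boundary o b β := by
  constructor
  · intro h
    -- Evaluated at `a`, the left side is the value at `0`, which is `1`, and the right side the
    -- value at `a - a'`, which is `1` only if this is a boundary.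
    have h' := congrFun (h _ (boundaryState_mem o hζ k)) a
    have h1 : boundaryState T d o k 0 = 1 := if_pos ⟨0, fun β => by simp [boundary]⟩
    rw [transl_apply, transl_apply, sub_self, h1] at h'
    by_contra hc
    refine one_ne_zero (h'.trans (if_neg ?_))
    rintro ⟨b, hb⟩
    exact hc ⟨b, fun β => by rw [← hb β]; simp⟩
  · rintro ⟨b, hb⟩ ψ hψ
    funext c
    rw [transl_apply, transl_apply]
    have : c - a = (c - a') - fun β => boundary o b β := by
      funext β
      simp only [Pi.sub_apply, hb]
      ring
    rw [this, apply_sub_boundary_of_mem_codeSpace o hψ]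

-- A coboundary pairs to zero with every cycle, and ground states vanish off the cycles.
include hζ in
theorem phase_eq_on_codeSpace {k : ℤ} {a a' : Cell T k → ZMod d}
    (h : ∃ b : Cell T (k - 1) → ZMod d, ∀ β, a β = a' β + dualBoundary o b β)
    {ψ : State T k d} (hψ : ψ ∈ codeSpace o ζ) :
    phase T k ζ hζ.pow_eq_one (.ofAdd a) ψ = phase T k ζ hζ.pow_eq_one (.ofAdd a') ψ := by
  obtain ⟨b, hb⟩ := h
  obtain rfl : a = a' + fun β => dualBoundary o b β := funext hb
  funext c
  rw [phase_apply, phase_apply]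
  by_cases hc : ψ c = 0
  · rw [hc, mul_zero, mul_zero]
  · have h0 : (fun α => boundary o c α) = (0 : Cell T (k - 1) → ZMod d) :=
      funext fun α => boundary_eq_zero_of_mem_codeSpace o hζ hψ hc α
    rw [pair_add_left, pair_dualBoundary, h0]
    simp [pair]

/-- Over `ℤ/d` with `d ≠ 0`, a vector that is orthogonal to all solutions of a homogeneous linear
system is a combination of the equations. -/
theorem exists_eq_sum_of_orthogonal [NeZero d] {ι κ : Type*} [Fintype ι] [Fintype κ]
    (A : κ → ι → ZMod d) (x : ι → ZMod d)
    (h : ∀ z : ι → ZMod d, (∀ α, ∑ β, A α β * z β = 0) → ∑ β, x β * z β = 0) :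
    ∃ c : κ → ZMod d, ∀ β, x β = ∑ α, A α β * c α := by
  let F : (κ → ZMod d) →+ (ι → ZMod d) :=
    { toFun := fun c β => ∑ α, A α β * c α
      map_zero' := by funext; simp
      map_add' := fun a b => by funext; simp [mul_add, Finset.sum_add_distrib] }
  -- In a finite abelian group a subgroup is the common kernel of the complex characters trivial on
  -- it. It remains to show that each such character kills `x`.
  have key : Multiplicative.ofAdd x ∈ F.range.toSubgroup := by
    rw [← CommGroup.forall_monoidHom_apply_eq_one_iff ℂ]
    intro φ hφ
    have hdpow : ∀ y : ι → ZMod d, ((φ (.ofAdd y) : ℂˣ) : ℂ) ^ d = 1 := fun y => by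
      rw [← Units.val_pow_eq_pow_val, ← map_pow, ← ofAdd_nsmul]
      have : d • y = 0 := by funext; simp
      rw [this, ofAdd_zero, map_one, Units.val_one]
    have hprim := Complex.isPrimitiveRoot_exp d (NeZero.ne d)
    set ξ := Complex.exp (2 * Real.pi * Complex.I / d) with hξ
    -- A character takes `d`-th roots of unity as values, so it is pairing with a vector `m`
    -- followed by the standard character. It is trivial on the range of `F` exactly if `m` solves
    -- the system.
    have hz : ∀ β : ι, ∃ m : ℕ, ξ ^ m = ((φ (.ofAdd (Pi.single β 1)) : ℂˣ) : ℂ) := fun β => by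
      obtain ⟨m, -, hm⟩ := hprim.eq_pow_of_pow_eq_one (hdpow (Pi.single β 1))
      exact ⟨m, hm⟩
    choose m hm using hz
    have hval : ∀ y : ι → ZMod d, ((φ (.ofAdd y) : ℂˣ) : ℂ) = ξ ^ (∑ β, (y β).val * m β) := by
      intro y
      have hy : y = ∑ β, (y β).val • (Pi.single β 1 : ι → ZMod d) := by
        funext β
        have hs : ∀ c, ((y c).val • (Pi.single c 1 : ι → ZMod d)) β
            = y c * (Pi.single c 1 : ι → ZMod d) β := fun c => by
          rw [Pi.smul_apply, nsmul_eq_mul, ZMod.natCast_zmod_val]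
        simp only [Finset.sum_apply, hs]
        simp [Pi.single_apply]
      conv_lhs => rw [hy]
      rw [ofAdd_sum, map_prod, Units.coe_prod, ← Finset.prod_pow_eq_pow_sum]
      refine Finset.prod_congr rfl fun β _ => ?_
      rw [ofAdd_nsmul, map_pow, Units.val_pow_eq_pow_val, ← hm, ← pow_mul, mul_comm]
    have hone : ∀ y : ι → ZMod d, φ (.ofAdd y) = 1 ↔ ∑ β, y β * (m β : ZMod d) = 0 := by
      intro y
      rw [← Units.val_eq_one, hval, hprim.pow_eq_one_iff_dvd, ← ZMod.natCast_eq_zero_iff]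
      simp
    rw [hone]
    refine h _ fun α => (hone _).mp (hφ _ ?_)
    refine ⟨Pi.single α 1, ?_⟩
    funext β
    simp [F, Pi.single_apply]
  obtain ⟨c, hc⟩ := key
  exact ⟨c, fun β => (congrFun hc β).symm⟩

-- Compared on the sum of all cycles, equal phases say that `a - a'` is orthogonal to every cycle;
-- the cycles are the solutions of the system whose rows are the coboundaries of the `(k-1)`-cells.
-- Over `ℤ` orthogonality would not suffice: `1` is orthogonal to all solutions of `2z = 0` but is
-- no multiple of `2`.
include hζ in
theorem exists_dualBoundary_of_phase_eq_on_codeSpace {k : ℕ} (hd : d ≠ 0)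
    {a a' : Cell T k → ZMod d}
    (h : ∀ ψ ∈ codeSpace (T := T) (k := k) (d := d) o ζ,
      phase T k ζ hζ.pow_eq_one (.ofAdd a) ψ = phase T k ζ hζ.pow_eq_one (.ofAdd a') ψ) :
    ∃ b : Cell T (k - 1) → ZMod d, ∀ β, a β = a' β + dualBoundary o b β := by
  have : NeZero d := ⟨hd⟩
  obtain ⟨b, hb⟩ := exists_eq_sum_of_orthogonal
    (fun (α : Cell T (k - 1)) (β : Cell T k) => (o.inc β.1 α.1 : ZMod d)) (a - a') (by
      intro z hz
      have h' := congrFun (h _ (cycleState_mem o hζ k)) z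
      have h1 : cycleState T d o k z = 1 := if_pos hz
      rw [phase_apply, phase_apply, h1, mul_one, mul_one] at h'
      refine (zetaChar_eq_one_iff hζ _).mp ?_
      show zetaChar ζ hζ.pow_eq_one (pair (a - a') z) = 1
      rw [pair_sub_left, sub_eq_add_neg, AddChar.map_add_eq_mul, h', ← AddChar.map_add_eq_mul,
        add_neg_cancel, AddChar.map_zero_eq_one])
  refine ⟨b, fun β => ?_⟩
  rw [dualBoundary, ← hb β]
  simp

end Equality

theorem unit_intCast_zmod_ne_zero {d : ℕ} (hd : d ≠ 1) (s : ℤˣ) : ((s : ℤ) : ZMod d) ≠ 0 := by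
  have := ZMod.nontrivial_iff.mpr hd
  rcases Int.units_eq_one_or s with rfl | rfl <;> simp

theorem image_erase_of_injOn {V W : Type*} {f : W → V} {s : Finset W} (hf : Set.InjOn f s) {x : W}
    (hx : x ∈ s) : (s.erase x).image f = (s.image f).erase (f x) := by
  ext y
  simp only [Finset.mem_image, Finset.mem_erase]
  constructor
  · rintro ⟨z, ⟨hzx, hz⟩, rfl⟩
    exact ⟨fun h => hzx (hf hz hx h), z, hz, rfl⟩
  · rintro ⟨hy, z, hz, rfl⟩
    exact ⟨z, ⟨fun h => hy (h ▸ rfl), hz⟩, rfl⟩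

theorem card_eq_card_add_one {V : Type u} {T : AbstractSimplicialComplex V} {k : ℕ}
    (γ : Cell T (k + 1)) (β : Cell T k) : γ.1.card = β.1.card + 1 := by
  have h1 := γ.2.2
  have h2 := β.2.2
  omega

/-! ### Boundaries of `V`-error sub-pseudo-manifolds -/

namespace VError

variable {V : Type u} {T : AbstractSimplicialComplex V} {k : ℕ} (E : VError T k)

theorem injOn_face {s : Finset E.W} (hs : s ∈ E.R.faces) : Set.InjOn E.map s :=
  Finset.card_image_iff.mp (E.card_image hs)

theorem card_top_eq {τ : Cell E.R (k - 1)} (ρ : Cell E.R k) : ρ.1.card = τ.1.card + 1 := by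
  have h1 := τ.2.2
  have h2 := ρ.2.2
  omega

/-- The chain map property on one simplex. As `f` is injective on `ρ`, every facet of the image is
the image of exactly one facet of `ρ`, and `Orientation.inc_image` compares the signs. -/
theorem sum_sign_mul_inc (o : Orientation V) (ρ : Cell E.R k) (α : Cell T (k - 1)) :
    ∑ τ : Cell E.R (k - 1), (if E.cell τ = α then (E.sign o τ : ℤ) * E.or.inc ρ.1 τ.1 else 0)
      = E.sign o ρ * o.inc (E.cell ρ).1 α.1 := by
  have hinj := E.injOn_face ρ.2.1
  have key : ∀ τ : Cell E.R (k - 1), τ.1 ⊆ ρ.1 → E.cell τ = α →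
      (E.sign o τ : ℤ) * E.or.inc ρ.1 τ.1 = E.sign o ρ * o.inc (E.cell ρ).1 α.1 := by
    intro τ hτ hα
    obtain ⟨x, hx, hxτ⟩ := exists_erase_eq hτ (E.card_top_eq ρ)
    have h := E.or.inc_image o hinj hx
    rw [hxτ] at h
    rw [← hα]
    show (E.sign o τ : ℤ) * E.or.inc ρ.1 τ.1
      = E.sign o ρ * o.inc (ρ.1.image E.map) (τ.1.image E.map)
    rw [h]
    change _ = (E.sign o ρ : ℤ) * ((E.sign o ρ : ℤ) * (E.sign o τ : ℤ) * E.or.inc ρ.1 τ.1)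
    rcases Int.units_eq_one_or (E.sign o ρ) with h' | h' <;> rw [h'] <;> simp
  by_cases hα : ∃ τ : Cell E.R (k - 1), τ.1 ⊆ ρ.1 ∧ E.cell τ = α
  · obtain ⟨τ, hτ, hτα⟩ := hα
    rw [Finset.sum_eq_single τ, if_pos hτα, key τ hτ hτα]
    · intro σ _ hσ
      rw [ite_eq_right_iff]
      intro hσα
      rw [mul_eq_zero, or_iff_right (E.sign o σ).ne_zero]
      by_contra h0
      refine hσ (Subtype.ext ?_)
      exact Finset.image_injOn_powerset_of_injOn hinj (by simpa using E.or.subset_of_inc_ne_zero h0)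
        (by simpa using hτ) (congrArg Subtype.val (hσα.trans hτα.symm))
    · simp
  · have h0 : o.inc (E.cell ρ).1 α.1 = 0 := by
      by_contra hne
      obtain ⟨y, hy, hyα⟩ := o.exists_erase_of_inc_ne_zero hne
      obtain ⟨x, hx, rfl⟩ := Finset.mem_image.mp hy
      have himg : (ρ.1.erase x).image E.map = α.1 := by
        rw [← hyα]
        exact image_erase_of_injOn hinj hx
      have hmem : ρ.1.erase x ∈ E.R.faces := (E.R.isRelLowerSet_faces ρ.2.1).2
        (Finset.erase_subset x _)
        (Finset.image_nonempty.mp (himg ▸ (T.isRelLowerSet_faces α.2.1).1))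
      refine hα ⟨⟨ρ.1.erase x, hmem, ?_⟩, Finset.erase_subset x _, Subtype.ext himg⟩
      have := Finset.card_erase_add_one hx
      have := ρ.2.2
      omega
    rw [h0, mul_zero]
    refine Finset.sum_eq_zero fun τ _ => ?_
    rw [ite_eq_right_iff]
    intro hτ
    by_contra hne
    exact hα ⟨τ, E.or.subset_of_inc_ne_zero (right_ne_zero_of_mul hne), hτ⟩

/-- An interior facet lies in exactly two top cells, which induce opposite orientations. -/
theorem sum_inc_of_not_isBoundary {τ : Cell E.R (k - 1)} (h : ¬ E.IsBoundary τ) :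
    ∑ ρ : Cell E.R k, E.or.inc ρ.1 τ.1 = 0 := by
  rcases E.isPseudomanifold.one_or_two τ with h1 | h2
  · obtain ⟨ρ, hρ⟩ := Set.ncard_eq_one.mp h1
    refine absurd ⟨ρ, ?_, fun ρ' h' => ?_⟩ h
    · exact (hρ ▸ Set.mem_singleton ρ : ρ ∈ {ρ : Cell E.R k | τ.1 ⊆ ρ.1})
    · exact (hρ ▸ h' : ρ' ∈ ({ρ} : Set _))
  · obtain ⟨ρ, ρ', hne, hs⟩ := Set.ncard_eq_two.mp h2
    have hρ : ρ ∈ {ρ : Cell E.R k | τ.1 ⊆ ρ.1} := hs ▸ Set.mem_insert ρ _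
    have hρ' : ρ' ∈ {ρ : Cell E.R k | τ.1 ⊆ ρ.1} := hs ▸ Set.mem_insert_of_mem ρ rfl
    rw [Finset.sum_eq_add ρ ρ' hne, E.isPseudomanifold.oriented τ ρ ρ' hne hρ hρ',
      neg_add_cancel]
    · intro σ _ hσ
      by_contra h0
      have : σ ∈ {ρ : Cell E.R k | τ.1 ⊆ ρ.1} := E.or.subset_of_inc_ne_zero h0
      rw [hs] at this
      rcases this with h | h
      · exact hσ.1 h
      · exact hσ.2 h
    · simp
    · simp

theorem exists_unit_sum_inc_of_isBoundary {τ : Cell E.R (k - 1)} (h : E.IsBoundary τ) :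
    ∃ s : ℤˣ, ∑ ρ : Cell E.R k, E.or.inc ρ.1 τ.1 = s := by
  obtain ⟨ρ, hρ, huniq⟩ := h
  rw [Finset.sum_eq_single ρ]
  · exact E.or.exists_unit_inc hρ (E.card_top_eq ρ)
  · intro σ _ hσ
    by_contra h0
    exact hσ (huniq σ (E.or.subset_of_inc_ne_zero h0))
  · simp

theorem exists_isBoundary_of_boundaryChain_ne_zero {o : Orientation V} {α : Cell T (k - 1)}
    (h : E.boundaryChain o α ≠ 0) : ∃ τ, E.IsBoundary τ ∧ E.cell τ = α := by
  obtain ⟨τ, -, hτ⟩ := Finset.exists_ne_zero_of_sum_ne_zero h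
  exact ⟨τ, by by_contra hc; exact hτ (if_neg hc)⟩

theorem cell_injective (hinj : Function.Injective E.map) {j : ℤ} :
    Function.Injective (E.cell (j := j)) := fun _ _ h =>
  Subtype.ext (Finset.image_injective hinj (congrArg Subtype.val h))

variable [Fintype V]

/-- Summing the identity on single simplices and exchanging the sums collects the top cells around
each facet of the domain; only boundary facets survive. -/
theorem boundary_chain (o : Orientation V) (α : Cell T (k - 1)) :
    boundary o (E.chain o) α = E.boundaryChain o α := by
  calc boundary o (E.chain o) α
      = ∑ ρ : Cell E.R k, (E.sign o ρ : ℤ) * o.inc (E.cell ρ).1 α.1 := by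
        simp only [boundary, chain, Finset.mul_sum, Int.cast_id]
        rw [Finset.sum_comm]
        refine Finset.sum_congr rfl fun ρ _ => ?_
        rw [Finset.sum_eq_single (E.cell ρ)]
        · rw [if_pos rfl, mul_comm]
        · intro β _ hβ
          rw [if_neg hβ.symm, mul_zero]
        · simp
    _ = ∑ τ : Cell E.R (k - 1), ∑ ρ : Cell E.R k,
          if E.cell τ = α then (E.sign o τ : ℤ) * E.or.inc ρ.1 τ.1 else 0 := by
        rw [Finset.sum_comm]
        exact Finset.sum_congr rfl fun ρ _ => (E.sum_sign_mul_inc o ρ α).symm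
    _ = E.boundaryChain o α := by
        refine Finset.sum_congr rfl fun τ _ => ?_
        by_cases hτ : E.cell τ = α
        · simp only [hτ, if_true, and_true]
          rw [← Finset.mul_sum]
          split_ifs with hb
          · rfl
          · rw [E.sum_inc_of_not_isBoundary hb, mul_zero]
        · simp [hτ]

/-- Under an injective map no two boundary facets have the same image, so each contributes a
coefficient `±1` that nothing cancels. -/
theorem boundary_chain_ne_zero_iff_of_injective (o : Orientation V) {d : ℕ} (hd : d ≠ 1)
    (hinj : Function.Injective E.map) (α : Cell T (k - 1)) :
    boundary o (fun β => (E.chain o β : ZMod d)) α ≠ 0 ↔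
      ∃ τ, E.IsBoundary τ ∧ E.cell τ = α := by
  rw [boundary_intCast, boundary_chain]
  constructor
  · intro h
    exact E.exists_isBoundary_of_boundaryChain_ne_zero (o := o) fun h0 => h (by rw [h0, Int.cast_zero])
  · rintro ⟨τ, hτ, rfl⟩
    obtain ⟨s, hs⟩ := E.exists_unit_sum_inc_of_isBoundary hτ
    rw [boundaryChain, Finset.sum_eq_single τ, if_pos ⟨hτ, rfl⟩, hs, ← Units.val_mul]
    · exact unit_intCast_zmod_ne_zero hd _
    · intro σ _ hσ
      exact if_neg fun h => hσ (E.cell_injective hinj h.2)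
    · simp

theorem operator_eq_transl (o : Orientation V) (d : ℕ) :
    E.operator o d = transl d T k (.ofAdd fun β => (E.chain o β : ZMod d)) := by
  rw [operator, prodX_eq_transl]
  rfl

end VError

/-! ### Boundaries of `P`-error sub-cellulations -/

namespace PError

variable {V : Type u} [Fintype V] {T : AbstractSimplicialComplex V} {o : Orientation V} {n k : ℕ}
  (E : PError T o n k)

theorem map_top_eq (ρ : E.Top) : E.map ρ.1 = DualCell.ofCell (E.cell ρ) :=
  DualCell.ext rfl (E.map_top ρ.1 ρ.2)

theorem dim_eq_of_map_eq {τ : E.R.Cell} {γ : Cell T (k + 1)} (h : E.map τ = DualCell.ofCell γ) :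
    E.R.dim τ = n - k - 1 := by
  rw [← E.map_dim, h]
  have := γ.2.2
  simp only [DualCell.dim, DualCell.ofCell]
  simp
  omega

theorem inc_of_map_eq {τ : E.R.Cell} {γ : Cell T (k + 1)} (h : E.map τ = DualCell.ofCell γ)
    (ρ : E.Top) : DualCell.inc o (E.map ρ) (E.map τ) = o.inc γ.1 (E.cell ρ).1 := by
  rw [h, E.map_top_eq]
  rfl

theorem ofCell_le_map_iff (ρ : E.Top) (γ : Cell T (k + 1)) :
    DualCell.ofCell γ ≤ E.map ρ.1 ↔ (E.cell ρ).1 ⊆ γ.1 := by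
  rw [E.map_top_eq]
  exact ⟨fun h => h.1, fun h => ⟨h, fun h' => h'⟩⟩

/-- The counterpart of `VError.sum_sign_mul_inc`: a closed cell maps isomorphically, so a facet of
its image in `T̂` lifts to exactly one facet. Facets mapped to `∂T̂` do not match any
`DualCell.ofCell γ` and drop out. -/
theorem sum_inc_eq (ρ : E.Top) (γ : Cell T (k + 1)) :
    ∑ τ : E.R.Cell, (if E.map τ = DualCell.ofCell γ then
      (if τ ≤ ρ then (E.sign ρ : ℤ) * DualCell.inc o (E.map ρ) (E.map τ) else 0) else 0)
      = E.sign ρ * o.inc γ.1 (E.cell ρ).1 := by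
  by_cases h : (E.cell ρ).1 ⊆ γ.1
  · obtain ⟨τ, ⟨hτ, hγ⟩, huniq⟩ := E.map_lift ρ.1 _ ((E.ofCell_le_map_iff ρ γ).mpr h)
    rw [Finset.sum_eq_single τ, if_pos hγ, if_pos hτ, E.inc_of_map_eq hγ]
    · intro σ _ hσ
      rw [ite_eq_right_iff, ite_eq_right_iff]
      exact fun h1 h2 => absurd (huniq σ ⟨h2, h1⟩) hσ
    · simp
  · have h0 : o.inc γ.1 (E.cell ρ).1 = 0 := by
      by_contra hne
      exact h (o.subset_of_inc_ne_zero hne)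
    rw [h0, mul_zero]
    refine Finset.sum_eq_zero fun τ _ => ?_
    rw [ite_eq_right_iff, ite_eq_right_iff]
    exact fun h1 h2 => absurd ((E.ofCell_le_map_iff ρ γ).mp (h1 ▸ E.map_mono _ _ h2)) h

theorem sum_sign_of_not_isBoundary {τ : E.R.Cell} (hd : E.R.dim τ = n - k - 1)
    (h : ¬ E.IsBoundary τ) :
    ∑ ρ : E.Top, (if τ ≤ ρ then (E.sign ρ : ℤ) * DualCell.inc o (E.map ρ) (E.map τ) else 0)
      = 0 := by
  rcases E.one_or_two τ hd with h1 | h2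
  · obtain ⟨ρ, hρ⟩ := Set.ncard_eq_one.mp h1
    refine absurd ⟨hd, ρ, ?_, fun ρ' h' => ?_⟩ h
    · exact (hρ ▸ Set.mem_singleton ρ : ρ ∈ {ρ : E.Top | τ ≤ ρ})
    · exact (hρ ▸ h' : ρ' ∈ ({ρ} : Set _))
  · obtain ⟨ρ, ρ', hne, hs⟩ := Set.ncard_eq_two.mp h2
    have hρ : ρ ∈ {ρ : E.Top | τ ≤ ρ} := hs ▸ Set.mem_insert ρ _
    have hρ' : ρ' ∈ {ρ : E.Top | τ ≤ ρ} := hs ▸ Set.mem_insert_of_mem ρ rfl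
    rw [Finset.sum_eq_add ρ ρ' hne, if_pos (show τ ≤ ρ.1 from hρ), if_pos (show τ ≤ ρ'.1 from hρ'), E.oriented τ hd ρ ρ' hne hρ hρ',
      neg_add_cancel]
    · intro σ _ hσ
      refine if_neg fun h0 => ?_
      have : σ ∈ {ρ : E.Top | τ ≤ ρ} := h0
      rw [hs] at this
      rcases this with h | h
      · exact hσ.1 h
      · exact hσ.2 h
    · simp
    · simp

theorem dualBoundary_chain (γ : Cell T (k + 1)) :
    dualBoundary o E.chain γ = E.boundaryChain γ := by
  calc dualBoundary o E.chain γ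
      = ∑ ρ : E.Top, (E.sign ρ : ℤ) * o.inc γ.1 (E.cell ρ).1 := by
        simp only [dualBoundary, chain, Finset.mul_sum, Int.cast_id]
        rw [Finset.sum_comm]
        refine Finset.sum_congr rfl fun ρ _ => ?_
        rw [Finset.sum_eq_single (E.cell ρ)]
        · rw [if_pos rfl, mul_comm]
        · intro β _ hβ
          rw [if_neg hβ.symm, mul_zero]
        · simp
    _ = ∑ τ : E.R.Cell, ∑ ρ : E.Top, if E.map τ = DualCell.ofCell γ then
          (if τ ≤ ρ then (E.sign ρ : ℤ) * DualCell.inc o (E.map ρ) (E.map τ) else 0) else 0 := by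
        rw [Finset.sum_comm]
        exact Finset.sum_congr rfl fun ρ _ => (E.sum_inc_eq ρ γ).symm
    _ = E.boundaryChain γ := by
        refine Finset.sum_congr rfl fun τ _ => ?_
        by_cases hτ : E.map τ = DualCell.ofCell γ
        · by_cases hb : E.IsBoundary τ
          · rw [if_pos ⟨hb, hτ⟩]
            exact Finset.sum_congr rfl fun ρ _ => if_pos hτ
          · rw [if_neg fun h => hb h.1]
            refine Eq.trans (Finset.sum_congr rfl fun ρ _ => if_pos hτ) ?_
            exact E.sum_sign_of_not_isBoundary (E.dim_eq_of_map_eq hτ) hb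
        · rw [if_neg fun h => hτ h.2]
          exact Finset.sum_eq_zero fun ρ _ => if_neg hτ

theorem exists_isBoundary_of_boundaryChain_ne_zero {γ : Cell T (k + 1)}
    (h : E.boundaryChain γ ≠ 0) : ∃ τ, E.IsBoundary τ ∧ E.map τ = DualCell.ofCell γ := by
  obtain ⟨τ, -, hτ⟩ := Finset.exists_ne_zero_of_sum_ne_zero h
  exact ⟨τ, by by_contra hc; exact hτ (if_neg hc)⟩

theorem dualBoundary_chain_ne_zero_iff_of_injective {d : ℕ} (hd : d ≠ 1)
    (hinj : Function.Injective E.map) (γ : Cell T (k + 1)) :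
    dualBoundary o (fun β => (E.chain β : ZMod d)) γ ≠ 0 ↔
      ∃ τ, E.IsBoundary τ ∧ E.map τ = DualCell.ofCell γ := by
  rw [dualBoundary_intCast, dualBoundary_chain]
  constructor
  · intro h
    exact E.exists_isBoundary_of_boundaryChain_ne_zero fun h0 => h (by rw [h0, Int.cast_zero])
  · rintro ⟨τ, hτ, hγ⟩
    obtain ⟨ρ, hρ, huniq⟩ := hτ.2
    have hsub : (E.cell ρ).1 ⊆ γ.1 := (E.ofCell_le_map_iff ρ γ).mp (hγ ▸ E.map_mono _ _ hρ)
    obtain ⟨s, hs⟩ := o.exists_unit_inc hsub (card_eq_card_add_one γ _)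
    rw [boundaryChain, Finset.sum_eq_single τ, if_pos ⟨hτ, hγ⟩, Finset.sum_eq_single ρ,
      if_pos hρ, E.inc_of_map_eq hγ, hs, ← Units.val_mul]
    · exact unit_intCast_zmod_ne_zero hd _
    · exact fun σ _ hσ => if_neg fun h => hσ (huniq σ h)
    · simp
    · intro σ _ hσ
      exact if_neg fun h => hσ (hinj (h.2.trans hγ.symm))
    · simp

theorem operator_eq_phase {d : ℕ} {ζ : Circle} (hζ : ζ ^ d = 1) :
    E.operator d ζ = phase T k ζ hζ (.ofAdd fun β => (E.chain β : ZMod d)) := by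
  rw [operator, prodZ_eq_phase hζ]
  rfl

end PError

/-! ### Embedded pieces spanned by a set of cells -/

section Pieces

variable {V : Type u} {T : AbstractSimplicialComplex V} {n k : ℕ}

/-- Three numbers that are pairwise negatives of each other all vanish. So compatible orientations
already force the pseudo-manifold condition that a facet lies in at most two top cells. -/
theorem ncard_eq_one_or_two_of_alternating {ι : Type*} [Finite ι] {s : Set ι} (hne : s.Nonempty)
    (g : ι → ℤ) (h0 : ∀ i ∈ s, g i ≠ 0) (h : ∀ i ∈ s, ∀ j ∈ s, i ≠ j → g i = -g j) :
    s.ncard = 1 ∨ s.ncard = 2 := by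
  have h1 : 0 < s.ncard := hne.ncard_pos
  have h2 : s.ncard ≤ 2 := by
    by_contra! hc
    obtain ⟨a, ha, b, hb, c, hc, hab, hac, hbc⟩ := (Set.two_lt_ncard).mp hc
    have := h a ha b hb hab
    have := h a ha c hc hac
    have := h b hb c hc hbc
    exact h0 a ha (by omega)
  omega

/-- A sign on the cells, extended by `1` to all finite sets. -/
def extendSign {j : ℤ} (w : Cell T j → ℤˣ) (s : Finset V) : ℤˣ :=
  if h : s ∈ T.faces ∧ (s.card : ℤ) = j + 1 then w ⟨s, h⟩ else 1

theorem extendSign_cell {j : ℤ} (w : Cell T j → ℤˣ) (β : Cell T j) : extendSign w β.1 = w β :=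
  dif_pos β.2

/-- The pull-back of an orientation along an injective map, twisted by signs. -/
def Orientation.twist {W : Type u} (o : Orientation V) (f : W → V) (hf : Function.Injective f)
    (w : Finset V → ℤˣ) : Orientation W where
  sgn v := o.sgn (f ∘ v) * w (Finset.univ.image (f ∘ v))
  alternating {m} v hv π := by
    have h : Finset.univ.image (f ∘ v ∘ π) = Finset.univ.image (f ∘ v) := by
      ext x
      simp only [Finset.mem_image, Finset.mem_univ, true_and, Function.comp_apply]
      exact ⟨fun ⟨a, ha⟩ => ⟨π a, ha⟩, fun ⟨a, ha⟩ => ⟨π.symm a, by simpa using ha⟩⟩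
    rw [h, ← Function.comp_assoc, o.alternating _ (hf.comp hv), mul_assoc]

/-- The inclusion then has prescribed relative signs `w`, which is how a piece receives the given
error orientations. -/
theorem relSign_twist {W : Type u} (o : Orientation V) {f : W → V} (hf : Function.Injective f)
    (w : Finset V → ℤˣ) (s : Finset W) : relSign (o.twist f hf w) o f s = w (s.image f) := by
  show o.sgn (f ∘ enum s) * (o.sgn (f ∘ enum s) * w (Finset.univ.image (f ∘ enum s))) = _
  rw [← mul_assoc, Int.units_mul_self, one_mul, ← Finset.image_image, image_enum]

theorem Orientation.inc_twist {W : Type u} (o : Orientation V) {f : W → V}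
    (hf : Function.Injective f) (w : Finset V → ℤˣ) {p q : Finset W} (h : q ⊆ p)
    (hc : p.card = q.card + 1) :
    (o.twist f hf w).inc p q
      = w (q.image f) * (w (p.image f) * o.inc (p.image f) (q.image f)) := by
  obtain ⟨x, hx, rfl⟩ := exists_erase_eq h hc
  rw [(o.twist f hf w).inc_image o hf.injOn hx, relSign_twist, relSign_twist]
  generalize w (p.image f) = s
  generalize w ((p.erase x).image f) = t
  rcases Int.units_eq_one_or s with rfl | rfl <;> rcases Int.units_eq_one_or t with rfl | rfl <;>
    simp

/-- Two `k`-cells that share a `(k-1)`-cell. -/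
def VAdj (β β' : Cell T k) : Prop := ∃ α : Cell T (k - 1), α.1 ⊆ β.1 ∧ α.1 ⊆ β'.1

/-- Two `k`-cells whose dual cells share the dual of a `(k+1)`-cell. -/
def PAdj (β β' : Cell T k) : Prop := ∃ γ : Cell T (k + 1), β.1 ⊆ γ.1 ∧ β'.1 ⊆ γ.1

/-- The subcomplex generated by a set of cells. -/
def spanComplex {j : ℤ} (C : Set (Cell T j)) :
    AbstractSimplicialComplex {v : V // ∃ β ∈ C, v ∈ β.1} where
  faces := {s | s.Nonempty ∧ ∃ β ∈ C, s.image Subtype.val ⊆ β.1}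
  isRelLowerSet_faces := fun _ ⟨hs, β, hβ, hsβ⟩ =>
    ⟨hs, fun _ ht hne => ⟨hne, β, hβ, (Finset.image_subset_image ht).trans hsβ⟩⟩
  singleton_mem := fun v => by
    obtain ⟨β, hβ, hv⟩ := v.2
    exact ⟨Finset.singleton_nonempty v, β, hβ, by simpa using hv⟩

theorem spanComplex_image_mem {j : ℤ} {C : Set (Cell T j)} {s}
    (hs : s ∈ (spanComplex C).faces) : s.image Subtype.val ∈ T.faces := by
  obtain ⟨hne, β, -, h⟩ := hs
  exact (T.isRelLowerSet_faces β.2.1).2 h (hne.image _)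

theorem exists_spanComplex_cell {j i : ℤ} {C : Set (Cell T j)} {β : Cell T j} (hβ : β ∈ C)
    (α : Cell T i) (h : α.1 ⊆ β.1) :
    ∃ τ : Cell (spanComplex C) i, τ.1.image Subtype.val = α.1 := by
  have himg : (α.1.subtype fun v => ∃ β ∈ C, v ∈ β.1).image Subtype.val = α.1 := by
    ext x
    simp only [Finset.mem_image, Finset.mem_subtype, Subtype.exists, exists_and_right,
      exists_eq_right]
    exact ⟨fun hx => hx.2, fun hx => ⟨⟨β, hβ, h hx⟩, hx⟩⟩
  refine ⟨⟨α.1.subtype _, ⟨?_, β, hβ, himg.trans_subset h⟩, ?_⟩, himg⟩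
  · exact Finset.image_nonempty.mp (himg ▸ (T.isRelLowerSet_faces α.2.1).1)
  · have hc := congrArg Finset.card himg
    rw [Finset.card_image_of_injective _ Subtype.val_injective] at hc
    rw [hc, α.2.2]

theorem spanComplex_top_mem {j : ℤ} {C : Set (Cell T j)} (ρ : Cell (spanComplex C) j) :
    ∃ β ∈ C, ρ.1.image Subtype.val = β.1 := by
  obtain ⟨-, β, hβ, h⟩ := ρ.2.1
  refine ⟨β, hβ, Finset.eq_of_subset_of_card_le h ?_⟩
  rw [Finset.card_image_of_injective _ Subtype.val_injective]
  have h1 := β.2.2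
  have h2 := ρ.2.2
  omega

namespace DualCell

theorem eq_of_le_of_dim_eq {x y : DualCell T n} (h : x ≤ y) (hd : x.dim = y.dim) : x = y := by
  by_contra hne
  exact absurd (dim_lt (lt_of_le_of_ne h hne)) (by omega)

theorem dim_ofCell {j : ℤ} (β : Cell T j) : (ofCell β : DualCell T n).dim = n - j := by
  have := β.2.2
  simp only [dim, ofCell]
  simp
  omega

/-- A cell of codimension one in the dual of a `k`-cell is dual to a `(k+1)`-cell or is the cell of
`∂T̂` dual to the same `k`-cell. -/
theorem facet_cases {x : DualCell T n} {β : Cell T k} (h : x ≤ ofCell β)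
    (hd : x.dim = n - k - 1) :
    (∃ γ : Cell T (k + 1), x = ofCell γ ∧ β.1 ⊆ γ.1) ∨ x.onBdry = true ∧ x.simplex = β.1 := by
  have hβ := β.2.2
  have hsub : β.1 ⊆ x.simplex := h.1
  by_cases hx : x.onBdry = true
  · refine Or.inr ⟨hx, (Finset.eq_of_subset_of_card_le hsub ?_).symm⟩
    simp only [dim, hx, if_true] at hd
    omega
  · refine Or.inl ⟨⟨x.simplex, x.mem, ?_⟩, DualCell.ext rfl (Bool.eq_false_of_not_eq_true hx), hsub⟩
    simp only [dim, hx] at hd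
    simp at hd
    omega

end DualCell

variable [Fintype V]

/-- A connected set of `k`-cells with compatible orientations spans an embedded `V`-error
sub-pseudo-manifold. -/
theorem exists_embedded_vError (o : Orientation V) (u : Cell T k → ℤˣ) {C : Set (Cell T k)}
    (hne : C.Nonempty)
    (hcomp : ∀ β ∈ C, ∀ β' ∈ C, ∀ α : Cell T (k - 1), β ≠ β' → α.1 ⊆ β.1 → α.1 ⊆ β'.1 →
      (u β : ℤ) * o.inc β.1 α.1 = -((u β' : ℤ) * o.inc β'.1 α.1))
    (hconn : ∀ β β' : C, Relation.ReflTransGen (fun a b : C => VAdj a.1 b.1) β β') :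
    ∃ E : VError T k, Function.Injective E.map ∧
      (∀ ρ : Cell E.R k, E.sign o ρ = u (E.cell ρ)) ∧ ∀ β, β ∈ C ↔ ∃ ρ, E.cell ρ = β := by
  have hinj : Function.Injective (Subtype.val : {v : V // ∃ β ∈ C, v ∈ β.1} → V) :=
    Subtype.val_injective
  have hsub : ∀ {s t : Finset {v : V // ∃ β ∈ C, v ∈ β.1}},
      s.image Subtype.val ⊆ t.image Subtype.val → s ⊆ t :=
    fun h => (Finset.image_subset_image_iff hinj).mp h
  have hcell : ∀ β : C, ∃ ρ : Cell (spanComplex C) k, ρ.1.image Subtype.val = β.1.1 := fun β =>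
    exists_spanComplex_cell β.2 β.1 subset_rfl
  choose top htop using hcell
  have hsurj : Function.Surjective top := fun ρ => by
    obtain ⟨β, hβ, h⟩ := spanComplex_top_mem ρ
    exact ⟨⟨β, hβ⟩, Subtype.ext (Finset.image_injective hinj ((htop ⟨β, hβ⟩).trans h.symm))⟩
  have hcard : ∀ (τ : Cell (spanComplex C) (k - 1)) (ρ : Cell (spanComplex C) k),
      ρ.1.card = τ.1.card + 1 := fun τ ρ => by
    have h1 := τ.2.2
    have h2 := ρ.2.2
    omega
  let or := o.twist (Subtype.val : {v : V // ∃ β ∈ C, v ∈ β.1} → V) hinj (extendSign u)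
  have hor : ∀ (τ : Cell (spanComplex C) (k - 1)) (ρ ρ' : Cell (spanComplex C) k), ρ ≠ ρ' →
      τ.1 ⊆ ρ.1 → τ.1 ⊆ ρ'.1 → or.inc ρ.1 τ.1 = -or.inc ρ'.1 τ.1 := by
    intro τ ρ ρ' hρ h h'
    obtain ⟨β, rfl⟩ := hsurj ρ
    obtain ⟨β', rfl⟩ := hsurj ρ'
    have hα := Finset.image_subset_image (f := Subtype.val) h
    have hα' := Finset.image_subset_image (f := Subtype.val) h'
    rw [htop] at hα hα'
    have hmem : τ.1.image Subtype.val ∈ T.faces := spanComplex_image_mem τ.2.1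
    have key := hcomp β.1 β.2 β'.1 β'.2 ⟨τ.1.image Subtype.val, hmem, by
      rw [Finset.card_image_of_injective _ hinj, τ.2.2]⟩
      (fun e => hρ (by rw [Subtype.ext e])) hα hα'
    rw [o.inc_twist hinj _ h (hcard τ _), o.inc_twist hinj _ h' (hcard τ _), htop, htop,
      extendSign_cell, extendSign_cell, key, mul_neg]
  have hpure : ∀ s ∈ (spanComplex C).faces, ∃ ρ : Cell (spanComplex C) k, s ⊆ ρ.1 := by
    rintro s ⟨-, β, hβ, h⟩
    exact ⟨top ⟨β, hβ⟩, hsub (by rwa [htop])⟩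
  have hpm : IsOrientedPseudomanifold (spanComplex C) or k :=
    { nonempty := ⟨top ⟨_, hne.some_mem⟩⟩
      pure := hpure
      one_or_two := fun τ => ncard_eq_one_or_two_of_alternating (hpure τ.1 τ.2.1)
        (fun ρ => or.inc ρ.1 τ.1)
        (fun ρ hρ => by
          obtain ⟨s, hs⟩ := or.exists_unit_inc hρ (hcard τ ρ)
          rw [hs]
          exact s.ne_zero)
        fun ρ hρ ρ' hρ' h => hor τ ρ ρ' h hρ hρ'
      connected := fun ρ ρ' => by
        obtain ⟨β, rfl⟩ := hsurj ρ
        obtain ⟨β', rfl⟩ := hsurj ρ'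
        refine (hconn β β').lift top ?_
        rintro a b ⟨α, ha, hb⟩
        obtain ⟨τ, hτ⟩ := exists_spanComplex_cell a.2 α ha
        exact ⟨τ, hsub (by rwa [htop, hτ]), hsub (by rwa [htop, hτ])⟩
      oriented := hor }
  let E : VError T k :=
    { W := {v : V // ∃ β ∈ C, v ∈ β.1}
      fin := inferInstance
      R := spanComplex C
      or := or
      isPseudomanifold := hpm
      map := Subtype.val
      simplicial := fun s hs => spanComplex_image_mem hs
      immersion := fun _ => hinj.injOn }
  refine ⟨E, hinj, fun ρ => ?_, fun β => ⟨fun hβ => ?_, ?_⟩⟩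
  · show relSign or o Subtype.val ρ.1 = _
    rw [relSign_twist]
    exact extendSign_cell u (E.cell ρ)
  · exact ⟨top ⟨β, hβ⟩, Subtype.ext (htop ⟨β, hβ⟩)⟩
  · rintro ⟨ρ, rfl⟩
    obtain ⟨β, hβ, h⟩ := spanComplex_top_mem ρ
    have : E.cell ρ = β := Subtype.ext h
    rwa [this]

/-- The lower set generated by the dual cells of a set of cells, as a cell complex. -/
def dualSpan (n : ℕ) {j : ℤ} (C : Set (Cell T j)) : CellComplex where
  Cell := {c : DualCell T n // ∃ β ∈ C, c ≤ DualCell.ofCell β}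
  fin := inferInstance
  order := inferInstance
  dim c := c.1.dim
  dim_lt _ _ h := DualCell.dim_lt h
  dim_covBy x y h := DualCell.dim_covBy
    ⟨h.1, fun z hxz hzy => by
      obtain ⟨β, hβ, hy⟩ := y.2
      exact h.2 (c := ⟨z, β, hβ, hzy.le.trans hy⟩) hxz hzy⟩

/-- A connected set of `k`-cells with compatible dual orientations spans an embedded `P`-error
sub-cellulation. -/
theorem exists_embedded_pError (o : Orientation V) (n : ℕ) (u : Cell T k → ℤˣ)
    {C : Set (Cell T k)} (hne : C.Nonempty)
    (hcomp : ∀ β ∈ C, ∀ β' ∈ C, ∀ γ : Cell T (k + 1), β ≠ β' → β.1 ⊆ γ.1 → β'.1 ⊆ γ.1 →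
      (u β : ℤ) * o.inc γ.1 β.1 = -((u β' : ℤ) * o.inc γ.1 β'.1))
    (hconn : ∀ β β' : C, Relation.ReflTransGen (fun a b : C => PAdj a.1 b.1) β β') :
    ∃ E : PError T o n k, Function.Injective E.map ∧
      (∀ ρ : E.Top, E.sign ρ = u (E.cell ρ)) ∧ ∀ β, β ∈ C ↔ ∃ ρ, E.cell ρ = β := by
  let top : C → {x : (dualSpan n C).Cell // (dualSpan n C).dim x = n - k} := fun β =>
    ⟨⟨DualCell.ofCell β.1, β.1, β.2, le_rfl⟩, DualCell.dim_ofCell β.1⟩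
  have hsurj : Function.Surjective top := fun ρ => by
    obtain ⟨β, hβ, h⟩ := ρ.1.2
    refine ⟨⟨β, hβ⟩, Subtype.ext (Subtype.ext ?_)⟩
    exact (DualCell.eq_of_le_of_dim_eq h (ρ.2.trans (DualCell.dim_ofCell β).symm)).symm
  have hpure : ∀ x : (dualSpan n C).Cell,
      ∃ ρ : {x : (dualSpan n C).Cell // (dualSpan n C).dim x = n - k}, x ≤ ρ := fun x => by
    obtain ⟨β, hβ, h⟩ := x.2
    exact ⟨top ⟨β, hβ⟩, h⟩
  let sign : {x : (dualSpan n C).Cell // (dualSpan n C).dim x = n - k} → ℤˣ := fun ρ =>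
    extendSign u ρ.1.1.simplex
  have hsign : ∀ β, sign (top β) = u β := fun β => extendSign_cell u β.1
  have hor : ∀ τ : (dualSpan n C).Cell, (dualSpan n C).dim τ = n - k - 1 →
      ∀ ρ ρ' : {x : (dualSpan n C).Cell // (dualSpan n C).dim x = n - k}, ρ ≠ ρ' → τ ≤ ρ → τ ≤ ρ' →
      (sign ρ : ℤ) * DualCell.inc o ρ.1.1 τ.1 = -((sign ρ' : ℤ) * DualCell.inc o ρ'.1.1 τ.1) := by
    intro τ hd ρ ρ' hρ h h'
    obtain ⟨β, rfl⟩ := hsurj ρ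
    obtain ⟨β', rfl⟩ := hsurj ρ'
    have hββ' : β.1 ≠ β'.1 := fun e => hρ (by rw [Subtype.ext e])
    -- A facet in `T̂` is covered by the compatibility hypothesis. A facet in `∂T̂` determines the
    -- `k`-cell, so it cannot lie in two different top cells.
    rcases DualCell.facet_cases (β := β.1) h hd with ⟨γ, hγ, hβγ⟩ | ⟨hb, hs⟩
    · have hβ'γ : β'.1.1 ⊆ γ.1 := by
        have h2 : τ.1 ≤ DualCell.ofCell β'.1 := h'
        rw [hγ] at h2
        exact h2.1
      rw [hsign, hsign, hγ]
      exact hcomp β.1 β.2 β'.1 β'.2 γ hββ' hβγ hβ'γ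
    · have hs' : β'.1.1 ⊆ τ.1.simplex := h'.1
      refine absurd (Subtype.ext (Finset.eq_of_subset_of_card_le (hs ▸ hs') ?_).symm) hββ'
      have h1 := β.1.2.2
      have h2 := β'.1.2.2
      omega
  have h0 : ∀ τ : (dualSpan n C).Cell, (dualSpan n C).dim τ = n - k - 1 →
      ∀ ρ : {x : (dualSpan n C).Cell // (dualSpan n C).dim x = n - k}, τ ≤ ρ →
      (sign ρ : ℤ) * DualCell.inc o ρ.1.1 τ.1 ≠ 0 := by
    intro τ hd ρ h
    obtain ⟨β, rfl⟩ := hsurj ρ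
    refine mul_ne_zero (sign _).ne_zero ?_
    rcases DualCell.facet_cases (β := β.1) h hd with ⟨γ, hγ, hβγ⟩ | ⟨hb, hs⟩
    · obtain ⟨s, hs⟩ := o.exists_unit_inc hβγ (card_eq_card_add_one γ β.1)
      rw [hγ]
      show o.inc γ.1 β.1.1 ≠ 0
      rw [hs]
      exact s.ne_zero
    · have : DualCell.inc o (top β).1.1 τ.1 = 1 := by
        simp only [DualCell.inc, hb, hs]
        simp [top, DualCell.ofCell]
      rw [this]
      exact one_ne_zero
  let E : PError T o n k :=
    { R := dualSpan n C
      map := Subtype.val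
      map_dim := fun _ => rfl
      map_mono := fun _ _ h => h
      map_lift := fun x c hc => by
        obtain ⟨β, hβ, h⟩ := x.2
        exact ⟨⟨c, β, hβ, hc.trans h⟩, ⟨hc, rfl⟩, fun y hy => Subtype.ext hy.2⟩
      immersion := fun _ => Subtype.val_injective.injOn
      map_top := fun x hx => by
        obtain ⟨β, hβ⟩ := hsurj ⟨x, hx⟩
        have : x.1 = DualCell.ofCell β.1 := congrArg (fun ρ => ρ.1.1) hβ.symm
        rw [this]
        rfl
      sign := sign
      nonempty := ⟨top ⟨_, hne.some_mem⟩⟩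
      pure := hpure
      one_or_two := fun τ hd => ncard_eq_one_or_two_of_alternating (hpure τ)
        (fun ρ => (sign ρ : ℤ) * DualCell.inc o ρ.1.1 τ.1) (h0 τ hd)
        fun ρ hρ ρ' hρ' h => hor τ hd ρ ρ' h hρ hρ'
      connected := fun ρ ρ' => by
        obtain ⟨β, rfl⟩ := hsurj ρ
        obtain ⟨β', rfl⟩ := hsurj ρ'
        refine (hconn β β').lift top ?_
        rintro a b ⟨γ, ha, hb⟩
        refine ⟨⟨DualCell.ofCell γ, a.1, a.2, ha, id⟩, ?_, ⟨ha, id⟩, ⟨hb, id⟩⟩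
        exact (DualCell.dim_ofCell γ).trans (by ring)
      oriented := hor }
  refine ⟨E, Subtype.val_injective, fun ρ => extendSign_cell u (E.cell ρ), fun β =>
    ⟨fun hβ => ⟨top ⟨β, hβ⟩, rfl⟩, ?_⟩⟩
  rintro ⟨ρ, rfl⟩
  obtain ⟨β, rfl⟩ := hsurj ρ
  exact β.2

end Pieces

/-! ### Greedy decompositions -/

section Greedy

/-- `C` is the connected component of `i` in `S`. The last clause asks for paths inside `C`, which
exist because each initial segment of a path from `i` ends in `C` and `r` is symmetric. -/
theorem exists_component {ι : Type*} {r : ι → ι → Prop} (hr : ∀ a b, r a b → r b a) {S : Set ι}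
    {i : ι} (hi : i ∈ S) :
    ∃ C ⊆ S, i ∈ C ∧ (∀ a ∈ C, ∀ b ∈ S, r a b → b ∈ C) ∧
      ∀ a b : C, Relation.ReflTransGen (fun a b : C => r a.1 b.1) a b := by
  let C : Set ι := {b | Relation.ReflTransGen (fun a b => b ∈ S ∧ r a b) i b}
  have hiC : i ∈ C := Relation.ReflTransGen.refl
  have hsub : C ⊆ S := fun b hb => by
    rcases Relation.ReflTransGen.cases_tail hb with rfl | ⟨_, _, h⟩
    · exact hi
    · exact h.1
  have hconn : ∀ b (hb : b ∈ C),
      Relation.ReflTransGen (fun a b : C => r a.1 b.1) ⟨i, hiC⟩ ⟨b, hb⟩ := by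
    intro b hb
    have aux : ∃ hb : b ∈ C,
        Relation.ReflTransGen (fun a b : C => r a.1 b.1) ⟨i, hiC⟩ ⟨b, hb⟩ := by
      change Relation.ReflTransGen _ i b at hb
      induction hb with
      | refl => exact ⟨hiC, .refl⟩
      | tail h1 h2 ih =>
        obtain ⟨hc, h⟩ := ih
        exact ⟨Relation.ReflTransGen.tail h1 h2, h.tail h2.2⟩
    exact aux.2
  refine ⟨C, hsub, hiC, fun a ha b hb hab => Relation.ReflTransGen.tail ha ⟨hb, hab⟩,
    fun a b => ?_⟩
  have hsymm : ∀ a b : C, Relation.ReflTransGen (fun a b : C => r a.1 b.1) a b →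
      Relation.ReflTransGen (fun a b : C => r a.1 b.1) b a := fun a b h => by
    induction h with
    | refl => exact .refl
    | tail _ h ih => exact .head (hr _ _ h) ih
  exact (hsymm _ _ (hconn a.1 a.2)).trans (hconn b.1 b.2)

/-- Applied with `f` the number of top cells and `g` the number of vertices or of all cells. Maximal
`f` means that nothing can be stitched on, minimal `g` that no two parts of the boundary can be
stitched together. -/
theorem exists_max_then_min {α : Type*} {P : α → Prop} (hP : ∃ a, P a) (f g : α → ℕ) (B : ℕ)
    (hB : ∀ a, P a → f a ≤ B) :
    ∃ a, P a ∧ ∀ b, P b → f a ≤ f b → f b = f a ∧ g a ≤ g b := by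
  obtain ⟨a, ha, hmax⟩ := WellFounded.has_min (measure fun a => B - f a).wf {a | P a} hP
  obtain ⟨c, ⟨hc, hca⟩, hmin⟩ :=
    WellFounded.has_min (measure g).wf {b | P b ∧ f b = f a} ⟨a, ha, rfl⟩
  refine ⟨c, hc, fun b hb hcb => ?_⟩
  have h1 : ¬ (B - f b < B - f a) := hmax b hb
  have h2 := hB b hb
  have h3 : f b = f a := by omega
  have h4 : ¬ (g b < g c) := hmin b ⟨hb, h3⟩
  omega

/-- Greedy removal of pieces, in a form that serves both types of error: `I a i` says that the facet
`a` meets the cell `i`, and `bd E a` that `a` is the image of a boundary cell of `E`. In the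
compatible case pieces take equally from all available cells around a facet. Equal degrees thus
remain equal until both are exhausted, so a boundary cell over `a` reveals a degree different from
all others there. -/
theorem exists_decomposition {X ι κ : Type*} [Fintype ι] (count : X → ι → ℕ) (sgn : X → Prop)
    (isMax : X → (ι → ℕ) → Prop) (bd : X → κ → Prop) (I : κ → ι → Prop)
    (compat : (ι → ℕ) → Prop) (hcompat : ∀ l l', (∀ i, l' i ≤ l i) → compat l → compat l')
    (step : ∀ l : ι → ℕ, (∃ i, 0 < l i) → ∃ E, (∀ i, count E i ≤ l i) ∧ (∃ i, 0 < count E i) ∧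
      sgn E ∧ isMax E l ∧ (compat l →
        (∀ a i j, I a i → I a j → 0 < l i → 0 < l j → count E i = count E j) ∧
        ∀ a, bd E a → ∃ i, I a i ∧ 0 < l i ∧ ∀ j, j ≠ i → I a j → l j = 0)) (l : ι → ℕ) :
    ∃ (N : ℕ) (R : Fin N → X), (∀ i, ∑ j, count (R j) i = l i) ∧ (∀ j, sgn (R j)) ∧
      (∀ j, isMax (R j) (fun i => ∑ m ∈ Finset.Ici j, count (R m) i)) ∧
      (compat l → ∀ a, (∃ j, bd (R j) a) →
        ∃ i, I a i ∧ 0 < l i ∧ ∀ j, j ≠ i → I a j → l j ≠ l i) := by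
  induction hm : ∑ i, l i using Nat.strong_induction_on generalizing l with
  | _ m ih =>
    by_cases hl : ∃ i, 0 < l i
    · obtain ⟨E, hle, ⟨i₀, hi₀⟩, hs, hmax, hc⟩ := step l hl
      have hlt : ∑ i, (l i - count E i) < m := by
        rw [← hm]
        refine Finset.sum_lt_sum (fun i _ => Nat.sub_le _ _) ⟨i₀, Finset.mem_univ _, ?_⟩
        have := hle i₀
        omega
      obtain ⟨N, R, hcount, hsgn, hRmax, hbd⟩ := ih _ hlt (fun i => l i - count E i) rfl
      have htot : ∀ i, ∑ j : Fin (N + 1), count ((Fin.cons E R : Fin (N + 1) → X) j) i = l i := by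
        intro i
        rw [Fin.sum_univ_succ]
        simp only [Fin.cons_zero, Fin.cons_succ, hcount]
        have := hle i
        omega
      refine ⟨N + 1, Fin.cons E R, htot, ?_, ?_, ?_⟩
      · exact fun j => Fin.cases hs hsgn j
      · intro j
        refine Fin.cases ?_ (fun j => ?_) j
        -- The errors not used before the first piece are all of them.
        · have h0 : (Finset.Ici (0 : Fin (N + 1))) = Finset.univ := by ext; simp
          rw [h0]
          simp only [htot]
          exact hmax
        · rw [← Fin.map_succEmb_Ici]
          simp only [Finset.sum_map, Fin.coe_succEmb, Fin.cons_succ]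
          exact hRmax j
      · rintro hcl a ⟨j, hj⟩
        obtain ⟨heq, hE⟩ := hc hcl
        -- If `l j = l i` with both positive, the first piece lowers them by the same amount, so the
        -- remaining degrees would agree as well, against the induction hypothesis.
        have later : (∃ j, bd (R j) a) → ∃ i, I a i ∧ 0 < l i ∧ ∀ j, j ≠ i → I a j → l j ≠ l i := by
          intro h
          obtain ⟨i, hi, hpos, hi'⟩ := hbd (hcompat l _ (fun i => Nat.sub_le _ _) hcl) a h
          refine ⟨i, hi, by omega, fun j hji hj hlj => hi' j hji hj ?_⟩
          rw [heq a j i hj hi (by omega) (by omega), hlj]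
        revert hj
        refine Fin.cases (fun hj => ?_) (fun j hj => later ⟨j, hj⟩) j
        obtain ⟨i, hi, hpos, hi'⟩ := hE a hj
        exact ⟨i, hi, hpos, fun j hji hj => by rw [hi' j hji hj]; omega⟩
    · push Not at hl
      refine ⟨0, Fin.elim0, fun i => ?_, fun j => j.elim0, fun j => j.elim0,
        fun _ a ⟨j, _⟩ => j.elim0⟩
      have := hl i
      simp
      omega

/-- A combination of signs that alternate on the support of the degrees does not vanish modulo `d`
if one degree differs from all others. -/
theorem intCast_sum_ne_zero_of_alternating {ι : Type*} [Fintype ι] {d : ℕ} (x : ι → ℤ) (l : ι → ℕ)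
    (hd : d ≠ 0 → ∀ i, l i < d)
    (hcomp : ∀ i j, i ≠ j → 0 < l i → 0 < l j → x i ≠ 0 → x j ≠ 0 → x i = -x j)
    {i : ι} (s : ℤˣ) (hi : x i = s) (hpos : 0 < l i) (hne : ∀ j, j ≠ i → x j ≠ 0 → l j ≠ l i) :
    ((∑ j, x j * l j : ℤ) : ZMod d) ≠ 0 := by
  have hxi : x i ≠ 0 := by rw [hi]; exact s.ne_zero
  -- By alternation at most two indices have nonzero sign and positive degree. So `y` is `l i - l
  -- j`, or `l i` when `i` is alone; it is nonzero and smaller than `d` in absolute value.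
  obtain ⟨y, hy, hyd, hsum⟩ : ∃ y : ℤ, y ≠ 0 ∧ (d ≠ 0 → |y| < d) ∧ ∑ j, x j * l j = s * y := by
    by_cases h : ∃ j, j ≠ i ∧ x j ≠ 0 ∧ 0 < l j
    · obtain ⟨j, hji, hxj, hlj⟩ := h
      refine ⟨(l i : ℤ) - l j, ?_, ?_, ?_⟩
      · have := hne j hji hxj
        omega
      · intro h0
        have h1 := hd h0 i
        have h2 := hd h0 j
        rw [abs_lt]
        omega
      · rw [Finset.sum_eq_add i j hji.symm]
        · rw [← hi, hcomp j i hji hlj hpos hxj hxi]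
          ring
        · rintro m - ⟨hmi, hmj⟩
          by_contra h0
          have hxm := left_ne_zero_of_mul h0
          have hlm : 0 < l m := by
            have := right_ne_zero_of_mul h0
            omega
          have h1 := hcomp m i hmi hlm hpos hxm hxi
          have h2 := hcomp m j hmj hlm hlj hxm hxj
          have h3 := hcomp i j hji.symm hpos hlj hxi hxj
          omega
        · simp
        · simp
    · push Not at h
      refine ⟨l i, by omega, fun h0 => ?_, ?_⟩
      · have := hd h0 i
        rw [abs_lt]
        omega
      · rw [Finset.sum_eq_single i, hi]
        · intro j _ hj
          by_cases hxj : x j = 0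
          · rw [hxj, zero_mul]
          · have := h j hj hxj
            have : l j = 0 := by omega
            simp [this]
        · simp
  rw [hsum, Ne, ZMod.intCast_zmod_eq_zero_iff_dvd]
  intro hdvd
  have hdvd' : (d : ℤ) ∣ y := by
    rcases Int.units_eq_one_or s with h | h <;> rw [h] at hdvd <;> simpa using hdvd
  by_cases h0 : d = 0
  · subst h0
    exact hy (by simpa using hdvd')
  · exact hy (Int.eq_zero_of_abs_lt_dvd hdvd' (hyd h0))

end Greedy

/-! ### Maximal `V`-error sub-pseudo-manifolds -/

namespace VError

variable {V : Type u} {T : AbstractSimplicialComplex V} {k : ℕ}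

/-- Both simplices lie in the star of a common vertex, where the immersion is injective. -/
theorem eq_of_cell_eq (E : VError T k) {ρ ρ' : Cell E.R k} {τ : Finset E.W} (hne : τ.Nonempty)
    (h : τ ⊆ ρ.1) (h' : τ ⊆ ρ'.1) (hc : E.cell ρ = E.cell ρ') : ρ = ρ' := by
  obtain ⟨v, hv⟩ := hne
  have star : ∀ σ : Cell E.R k, v ∈ σ.1 → ∀ x ∈ σ.1, ({v, x} : Finset E.W) ∈ E.R.faces :=
    fun σ hσ x hx => (E.R.isRelLowerSet_faces σ.2.1).2
      (by intro y hy; simp only [Finset.mem_insert, Finset.mem_singleton] at hy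
          rcases hy with rfl | rfl <;> assumption) ⟨v, by simp⟩
  have sub : ∀ σ σ' : Cell E.R k, v ∈ σ.1 → v ∈ σ'.1 → E.cell σ = E.cell σ' → σ.1 ⊆ σ'.1 := by
    intro σ σ' hσ hσ' hcell x hx
    have hx' : E.map x ∈ (E.cell σ').1 := hcell ▸ Finset.mem_image_of_mem E.map hx
    obtain ⟨y, hy, hyx⟩ := Finset.mem_image.mp hx'
    rw [← E.immersion v (star σ' hσ' y hy) (star σ hσ x hx) hyx]
    exact hy
  exact Subtype.ext ((sub ρ ρ' (h hv) (h' hv) hc).antisymm (sub ρ' ρ (h' hv) (h hv) hc.symm))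

theorem count_pos (E : VError T k) (ρ : Cell E.R k) : 0 < E.count (E.cell ρ) :=
  (Set.ncard_pos (Set.toFinite _)).mpr ⟨ρ, rfl⟩

theorem sum_count [Fintype V] (E : VError T k) : ∑ β, E.count β = Fintype.card (Cell E.R k) := by
  rw [← Finset.card_univ, Finset.card_eq_sum_card_fiberwise (f := E.cell) (t := Finset.univ)
    (fun _ _ => Finset.mem_coe.mpr (Finset.mem_univ _))]
  refine Finset.sum_congr rfl fun β _ => ?_
  rw [count, Set.ncard_eq_toFinset_card']
  congr 1
  ext
  simp

variable {E E' : VError T k} {g : E.W → E'.W}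

theorem image_image_map (hmap : ∀ w, E'.map (g w) = E.map w) (s : Finset E.W) :
    (s.image g).image E'.map = s.image E.map := by
  rw [Finset.image_image]
  exact Finset.image_congr fun w _ => hmap w

/-- The map on cells induced by a simplicial map over `T`. -/
def mapCell (hg : ∀ s ∈ E.R.faces, s.image g ∈ E'.R.faces) (hmap : ∀ w, E'.map (g w) = E.map w)
    {j : ℤ} (s : Cell E.R j) : Cell E'.R j :=
  ⟨s.1.image g, hg _ s.2.1, by
    rw [← E'.card_image (hg _ s.2.1), image_image_map hmap, E.card_image s.2.1]
    exact s.2.2⟩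

theorem cell_mapCell (hg : ∀ s ∈ E.R.faces, s.image g ∈ E'.R.faces)
    (hmap : ∀ w, E'.map (g w) = E.map w) {j : ℤ} (s : Cell E.R j) :
    E'.cell (mapCell hg hmap s) = E.cell s := Subtype.ext (image_image_map hmap s.1)

/-- Every face lies in a top cell by purity, and a top cell in the image brings all its faces along.
-/
theorem exists_face_of_surjective (hg : ∀ s ∈ E.R.faces, s.image g ∈ E'.R.faces)
    (hmap : ∀ w, E'.map (g w) = E.map w) (hsurj : Function.Surjective (mapCell hg hmap (j := k))) :
    ∀ s' ∈ E'.R.faces, ∃ s ∈ E.R.faces, s.image g = s' := by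
  intro s' hs'
  obtain ⟨ρ', hρ'⟩ := E'.isPseudomanifold.pure s' hs'
  obtain ⟨ρ, rfl⟩ := hsurj ρ'
  have himg : (ρ.1.filter fun w => g w ∈ s').image g = s' := by
    ext x
    simp only [Finset.mem_image, Finset.mem_filter]
    constructor
    · rintro ⟨w, ⟨-, hw⟩, rfl⟩
      exact hw
    · intro hx
      obtain ⟨w, hw, rfl⟩ := Finset.mem_image.mp (hρ' hx)
      exact ⟨w, ⟨hw, hx⟩, rfl⟩
  refine ⟨_, (E.R.isRelLowerSet_faces ρ.2.1).2 (Finset.filter_subset _ _) ?_, himg⟩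
  exact Finset.image_nonempty.mp (himg ▸ (E'.R.isRelLowerSet_faces hs').1)

theorem surjective_of_exists_face (h : ∀ s' ∈ E'.R.faces, ∃ s ∈ E.R.faces, s.image g = s') :
    Function.Surjective g := by
  intro w'
  obtain ⟨s, -, hs⟩ := h {w'} (E'.R.singleton_mem w')
  obtain ⟨w, -, hw⟩ := Finset.mem_image.mp (hs ▸ Finset.mem_singleton_self w' : w' ∈ s.image g)
  exact ⟨w, hw⟩

/-- An embedded piece over a set of cells that is closed under adjacency among the available cells
is maximal. -/
theorem isMaximalIn_of_closed {o : Orientation V} {avail : Cell T k → ℕ} {u : Cell T k → ℤˣ}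
    (hinj : Function.Injective E.map)
    (hclosed : ∀ (ρ : Cell E.R k) (β : Cell T k), 0 < avail β → VAdj (E.cell ρ) β →
      ∃ ρ', E.cell ρ' = β) : E.IsMaximalIn o avail u := by
  intro E' havail _ g hg hmap _
  have hginj : Function.Injective g := fun a b hab =>
    hinj (by rw [← hmap a, ← hmap b, hab])
  -- Along a chain of adjacent top cells of `E'`, each next cell `b` is available and adjacent to a
  -- cell of `E`, so `E` has a cell `ρ'` over the same `k`-cell of `T`. Its image and `b` share the
  -- facet `τ`, and the immersion identifies them.
  have hsurj : Function.Surjective (mapCell hg hmap (j := k)) := by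
    intro σ
    obtain ⟨ρ₀⟩ := E.isPseudomanifold.nonempty
    have hconn := E'.isPseudomanifold.connected (mapCell hg hmap ρ₀) σ
    induction hconn with
    | refl => exact ⟨ρ₀, rfl⟩
    | @tail a b _ hab ih =>
      obtain ⟨ρ, rfl⟩ := ih
      obtain ⟨τ, hτa, hτb⟩ := hab
      have hpos : 0 < avail (E'.cell b) := (E'.count_pos b).trans_le (havail _)
      obtain ⟨ρ', hρ'⟩ := hclosed ρ (E'.cell b) hpos ⟨E'.cell τ, by
        rw [← cell_mapCell hg hmap]
        exact Finset.image_subset_image hτa, Finset.image_subset_image hτb⟩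
      refine ⟨ρ', E'.eq_of_cell_eq (τ := τ.1) (E'.R.isRelLowerSet_faces τ.2.1).1 ?_ hτb
        ((cell_mapCell hg hmap ρ').trans hρ')⟩
      -- A vertex of `τ` is the image of a vertex of `ρ`; since `E` is embedded, that vertex also
      -- belongs to `ρ'`.
      intro x hx
      obtain ⟨w, hw, rfl⟩ := Finset.mem_image.mp (hτa hx)
      have hmem : E.map w ∈ (E.cell ρ').1 := by
        rw [hρ', ← hmap]
        exact Finset.mem_image_of_mem _ (hτb hx)
      obtain ⟨w', hw', hww'⟩ := Finset.mem_image.mp hmem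
      rw [← hinj hww']
      exact Finset.mem_image_of_mem g hw'
  have hface := exists_face_of_surjective hg hmap hsurj
  exact ⟨⟨hginj, surjective_of_exists_face hface⟩, hface⟩

theorem count_eq_one (hinj : Function.Injective E.map) (ρ : Cell E.R k) :
    E.count (E.cell ρ) = 1 := by
  rw [count, Set.ncard_eq_one]
  refine ⟨ρ, Set.ext fun σ => ⟨fun h => E.cell_injective hinj h, fun h => ?_⟩⟩
  rw [Set.mem_singleton_iff.mp h]
  rfl

theorem count_eq_zero {β : Cell T k} (h : ¬ ∃ ρ, E.cell ρ = β) : E.count β = 0 := by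
  rw [count, Set.ncard_eq_zero]
  exact Set.eq_empty_of_forall_notMem fun ρ hρ => h ⟨ρ, hρ⟩

theorem count_le_of_forall_pos (hinj : Function.Injective E.map) {l : Cell T k → ℕ}
    (h : ∀ ρ, 0 < l (E.cell ρ)) (β : Cell T k) : E.count β ≤ l β := by
  by_cases hβ : ∃ ρ, E.cell ρ = β
  · obtain ⟨ρ, rfl⟩ := hβ
    rw [count_eq_one hinj]
    exact h ρ
  · rw [count_eq_zero hβ]
    exact Nat.zero_le _

variable [Fintype V]

/-- Among the available error cells there is a maximally connected piece. -/
theorem exists_isMaximalIn (o : Orientation V) (u : Cell T k → ℤˣ) {l : Cell T k → ℕ}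
    (hl : ∃ β, 0 < l β) :
    ∃ E : VError T k, (∀ β, E.count β ≤ l β) ∧ (∀ ρ : Cell E.R k, E.sign o ρ = u (E.cell ρ)) ∧
      E.IsMaximalIn o l u := by
  obtain ⟨β₀, hβ₀⟩ := hl
  -- A single available cell is already a piece.
  have hex : ∃ E : VError T k, (∀ β, E.count β ≤ l β) ∧
      ∀ ρ : Cell E.R k, E.sign o ρ = u (E.cell ρ) := by
    obtain ⟨E, hinj, hs, hC⟩ := exists_embedded_vError o u (Set.singleton_nonempty β₀)
      (fun β hβ β' hβ' _ hne => absurd (hβ.trans hβ'.symm) hne)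
      (fun β β' => by rw [Subsingleton.elim β β'])
    refine ⟨E, count_le_of_forall_pos hinj fun ρ => ?_, hs⟩
    rw [Set.mem_singleton_iff.mp ((hC _).mpr ⟨ρ, rfl⟩)]
    exact hβ₀
  -- The total degree bounds the number of top cells. A map to a competing piece is then bijective
  -- on top cells, hence surjective on vertices, and minimality of the vertex number makes it
  -- bijective.
  obtain ⟨E, ⟨hE, hs⟩, hmax⟩ := exists_max_then_min hex
    (fun E => Fintype.card (Cell E.R k)) (fun E => Fintype.card E.W) (∑ β, l β)
    (fun E hE => by rw [← E.sum_count]; exact Finset.sum_le_sum fun β _ => hE.1 β)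
  refine ⟨E, hE, hs, fun E' hE' hs' g hg hmap hinj => ?_⟩
  have hinj' : Function.Injective (mapCell hg hmap (j := k)) := fun ρ ρ' h =>
    hinj ρ ρ' (congrArg Subtype.val h)
  obtain ⟨hcard, hW⟩ := hmax E' ⟨hE', hs'⟩ (Fintype.card_le_of_injective _ hinj')
  have hsurj := ((Fintype.bijective_iff_injective_and_card _).mpr ⟨hinj', hcard.symm⟩).2
  have hface := exists_face_of_surjective hg hmap hsurj
  have hgs := surjective_of_exists_face hface
  exact ⟨(Fintype.bijective_iff_surjective_and_card g).mpr
    ⟨hgs, le_antisymm hW (Fintype.card_le_of_surjective g hgs)⟩, hface⟩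

/-- If the orientations are compatible, the maximally connected piece can be chosen as a full
component of the available error cells. -/
theorem exists_isMaximalIn_of_compatible (o : Orientation V) (u : Cell T k → ℤˣ)
    {l : Cell T k → ℕ} (hl : ∃ β, 0 < l β) (hcomp : VCompatible o l u) :
    ∃ E : VError T k, (∀ β, E.count β ≤ l β) ∧ (∀ ρ : Cell E.R k, E.sign o ρ = u (E.cell ρ)) ∧
      E.IsMaximalIn o l u ∧
      (∀ (α : Cell T (k - 1)) (β β' : Cell T k), α.1 ⊆ β.1 → α.1 ⊆ β'.1 → 0 < l β → 0 < l β' →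
        E.count β = E.count β') ∧
      ∀ α : Cell T (k - 1), (∃ τ, E.IsBoundary τ ∧ E.cell τ = α) →
        ∃ β : Cell T k, α.1 ⊆ β.1 ∧ 0 < l β ∧ ∀ β', β' ≠ β → α.1 ⊆ β'.1 → l β' = 0 := by
  obtain ⟨β₀, hβ₀⟩ := hl
  obtain ⟨C, hCS, hβC, hclosed, hconn⟩ := exists_component (r := VAdj (T := T) (k := k))
    (S := {β | 0 < l β}) (fun a b ⟨α, h, h'⟩ => ⟨α, h', h⟩) hβ₀
  obtain ⟨E, hinj, hs, hC⟩ := exists_embedded_vError o u ⟨β₀, hβC⟩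
    (fun β hβ β' hβ' α hne => hcomp β β' α hne (hCS hβ) (hCS hβ')) hconn
  have hmem : ∀ ρ, E.cell ρ ∈ C := fun ρ => (hC _).mpr ⟨ρ, rfl⟩
  refine ⟨E, count_le_of_forall_pos hinj fun ρ => hCS (hmem ρ), hs,
    isMaximalIn_of_closed hinj fun ρ β hβ hadj => (hC β).mp (hclosed _ (hmem ρ) β hβ hadj), ?_, ?_⟩
  · intro α β β' h h' hβ hβ'
    by_cases hm : β ∈ C
    · obtain ⟨ρ, rfl⟩ := (hC β).mp hm
      obtain ⟨ρ', rfl⟩ := (hC β').mp (hclosed _ hm β' hβ' ⟨α, h, h'⟩)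
      rw [count_eq_one hinj, count_eq_one hinj]
    · have hm' : β' ∉ C := fun hm' => hm (hclosed _ hm' β hβ ⟨α, h', h⟩)
      rw [count_eq_zero fun hex => hm ((hC β).mpr hex),
        count_eq_zero fun hex => hm' ((hC β').mpr hex)]
  · rintro α ⟨τ, ⟨ρ, hρ, huniq⟩, rfl⟩
    have hsub : (E.cell τ).1 ⊆ (E.cell ρ).1 := Finset.image_subset_image hρ
    refine ⟨E.cell ρ, hsub, hCS (hmem ρ), fun β' hne hβ' => ?_⟩
    -- A second available cell at the facet would belong to the component, so the facet would lie in
    -- two top cells of `E`.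
    by_contra h0
    obtain ⟨ρ', rfl⟩ := (hC β').mp
      (hclosed _ (hmem ρ) β' (Nat.pos_of_ne_zero h0) ⟨E.cell τ, hsub, hβ'⟩)
    have := huniq ρ' ((Finset.image_subset_image_iff hinj).mp hβ')
    exact hne (by rw [this])

end VError

/-! ### Maximal `P`-error sub-cellulations -/

namespace PError

variable {V : Type u} [Fintype V] {T : AbstractSimplicialComplex V} {o : Orientation V} {n k : ℕ}

theorem eq_of_cell_eq (E : PError T o n k) {ρ ρ' : E.Top} {τ : E.R.Cell}
    (h : τ ≤ ρ.1) (h' : τ ≤ ρ'.1) (hc : E.cell ρ = E.cell ρ') : ρ = ρ' :=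
  Subtype.ext (E.immersion τ h h' (by rw [E.map_top_eq, E.map_top_eq, hc]))

theorem count_pos (E : PError T o n k) (ρ : E.Top) : 0 < E.count (E.cell ρ) :=
  (Set.ncard_pos (Set.toFinite _)).mpr ⟨ρ, rfl⟩

theorem sum_count (E : PError T o n k) : ∑ β, E.count β = Fintype.card E.Top := by
  rw [← Finset.card_univ, Finset.card_eq_sum_card_fiberwise (f := E.cell) (t := Finset.univ)
    (fun _ _ => Finset.mem_coe.mpr (Finset.mem_univ _))]
  refine Finset.sum_congr rfl fun β _ => ?_
  rw [count, Set.ncard_eq_toFinset_card']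
  congr 1
  ext
  simp

variable {E E' : PError T o n k} {g : E.R.Cell → E'.R.Cell}

/-- The map on top-dimensional cells induced by a map over `cl(T̂)`. -/
def mapTop (hmap : ∀ x, E'.map (g x) = E.map x) (ρ : E.Top) : E'.Top :=
  ⟨g ρ.1, by rw [← E'.map_dim, hmap, E.map_dim, ρ.2]⟩

theorem cell_mapTop (hmap : ∀ x, E'.map (g x) = E.map x) (ρ : E.Top) :
    E'.cell (mapTop hmap ρ) = E.cell ρ := Subtype.ext (congrArg DualCell.simplex (hmap ρ.1))

/-- The image of `y` lifts to a face `x` of `ρ`, and `g x = y` because lifts in `E'` are unique. -/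
theorem exists_of_le_mapTop (hg : Monotone g) (hmap : ∀ x, E'.map (g x) = E.map x) {ρ : E.Top}
    {y : E'.R.Cell} (hy : y ≤ g ρ.1) : ∃ x ≤ ρ.1, g x = y := by
  have hle : E'.map y ≤ E.map ρ.1 := hmap ρ.1 ▸ E'.map_mono _ _ hy
  obtain ⟨x, ⟨hx, hxy⟩, -⟩ := E.map_lift ρ.1 _ hle
  exact ⟨x, hx, (E'.map_lift (g ρ.1) _ (E'.map_mono _ _ hy)).unique
    ⟨hg hx, (hmap x).trans hxy⟩ ⟨hy, rfl⟩⟩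

theorem surjective_of_mapTop_surjective (hg : Monotone g) (hmap : ∀ x, E'.map (g x) = E.map x)
    (hsurj : Function.Surjective (mapTop hmap)) : Function.Surjective g := by
  intro y
  obtain ⟨ρ', hρ'⟩ := E'.pure y
  obtain ⟨ρ, rfl⟩ := hsurj ρ'
  obtain ⟨x, -, hx⟩ := exists_of_le_mapTop hg hmap hρ'
  exact ⟨x, hx⟩

/-- An embedded piece over a set of cells that is closed under dual adjacency among the available
cells is maximal. -/
theorem isMaximalIn_of_closed {avail : Cell T k → ℕ} {u : Cell T k → ℤˣ}
    (hinj : Function.Injective E.map)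
    (hclosed : ∀ (ρ : E.Top) (β : Cell T k), 0 < avail β → PAdj (E.cell ρ) β →
      ∃ ρ', E.cell ρ' = β) : E.IsMaximalIn avail u := by
  intro E' havail _ g hg hmap _
  have hginj : Function.Injective g := fun a b hab =>
    hinj (by rw [← hmap a, ← hmap b, hab])
  have hsurj : Function.Surjective (mapTop hmap) := by
    intro σ
    obtain ⟨ρ₀⟩ := E.nonempty
    have hconn := E'.connected (mapTop hmap ρ₀) σ
    induction hconn with
    | refl => exact ⟨ρ₀, rfl⟩
    | @tail a b _ hab ih =>
      obtain ⟨ρ, rfl⟩ := ih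
      obtain ⟨τ, hd, hτa, hτb⟩ := hab
      have hla : E'.map τ ≤ DualCell.ofCell (E.cell ρ) := by
        rw [← cell_mapTop hmap, ← E'.map_top_eq]
        exact E'.map_mono _ _ hτa
      have hlb : E'.map τ ≤ DualCell.ofCell (E'.cell b) := by
        rw [← E'.map_top_eq]
        exact E'.map_mono _ _ hτb
      rw [← E'.map_dim] at hd
      -- A common facet in `T̂` is a dual adjacency, to which closedness applies. If it lies in
      -- `∂T̂`, then `b` lies over the same `k`-cell as `ρ` and is its image.
      rcases DualCell.facet_cases hla hd with ⟨γ, hγ, hργ⟩ | ⟨-, hs⟩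
      · have hbγ : (E'.cell b).1 ⊆ γ.1 := by
          rw [hγ] at hlb
          exact hlb.1
        have hpos : 0 < avail (E'.cell b) := (E'.count_pos b).trans_le (havail _)
        obtain ⟨ρ', hρ'⟩ := hclosed ρ (E'.cell b) hpos ⟨γ, hργ, hbγ⟩
        obtain ⟨x, hx, rfl⟩ := exists_of_le_mapTop hg hmap hτa
        have hle : E.map x ≤ E.map ρ'.1 := by
          rw [← hmap x, E.map_top_eq, hρ']
          exact hlb
        obtain ⟨y, ⟨hy, hyx⟩, -⟩ := E.map_lift ρ'.1 _ hle
        rw [hinj hyx] at hy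
        exact ⟨ρ', E'.eq_of_cell_eq (hg hy) hτb ((cell_mapTop hmap ρ').trans hρ')⟩
      · refine ⟨ρ, E'.eq_of_cell_eq hτa hτb ((cell_mapTop hmap ρ).trans (Subtype.ext ?_))⟩
        have hsub : (E'.cell b).1 ⊆ (E.cell ρ).1 := hs ▸ hlb.1
        refine (Finset.eq_of_subset_of_card_le hsub ?_).symm
        have h1 := (E.cell ρ).2.2
        have h2 := (E'.cell b).2.2
        omega
  exact ⟨hginj, surjective_of_mapTop_surjective hg hmap hsurj⟩

theorem cell_injective (hinj : Function.Injective E.map) : Function.Injective E.cell :=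
  fun ρ ρ' h => Subtype.ext (hinj (by rw [E.map_top_eq, E.map_top_eq, h]))

theorem count_eq_one (hinj : Function.Injective E.map) (ρ : E.Top) :
    E.count (E.cell ρ) = 1 := by
  rw [count, Set.ncard_eq_one]
  refine ⟨ρ, Set.ext fun σ => ⟨fun h => cell_injective hinj h, fun h => ?_⟩⟩
  rw [Set.mem_singleton_iff.mp h]
  rfl

theorem count_eq_zero {β : Cell T k} (h : ¬ ∃ ρ, E.cell ρ = β) : E.count β = 0 := by
  rw [count, Set.ncard_eq_zero]
  exact Set.eq_empty_of_forall_notMem fun ρ hρ => h ⟨ρ, hρ⟩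

theorem count_le_of_forall_pos (hinj : Function.Injective E.map) {l : Cell T k → ℕ}
    (h : ∀ ρ, 0 < l (E.cell ρ)) (β : Cell T k) : E.count β ≤ l β := by
  by_cases hβ : ∃ ρ, E.cell ρ = β
  · obtain ⟨ρ, rfl⟩ := hβ
    rw [count_eq_one hinj]
    exact h ρ
  · rw [count_eq_zero hβ]
    exact Nat.zero_le _

/-- Among the available error cells there is a maximally connected piece. -/
theorem exists_isMaximalIn (o : Orientation V) (n : ℕ) (u : Cell T k → ℤˣ) {l : Cell T k → ℕ}
    (hl : ∃ β, 0 < l β) :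
    ∃ E : PError T o n k, (∀ β, E.count β ≤ l β) ∧ (∀ ρ : E.Top, E.sign ρ = u (E.cell ρ)) ∧
      E.IsMaximalIn l u := by
  obtain ⟨β₀, hβ₀⟩ := hl
  have hex : ∃ E : PError T o n k, (∀ β, E.count β ≤ l β) ∧
      ∀ ρ : E.Top, E.sign ρ = u (E.cell ρ) := by
    obtain ⟨E, hinj, hs, hC⟩ := exists_embedded_pError o n u (Set.singleton_nonempty β₀)
      (fun β hβ β' hβ' _ hne => absurd (hβ.trans hβ'.symm) hne)
      (fun β β' => by rw [Subsingleton.elim β β'])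
    refine ⟨E, count_le_of_forall_pos hinj fun ρ => ?_, hs⟩
    rw [Set.mem_singleton_iff.mp ((hC _).mpr ⟨ρ, rfl⟩)]
    exact hβ₀
  -- All cells are counted in the second place, not only vertices, because a map of cellulations is
  -- a map on cells.
  obtain ⟨E, ⟨hE, hs⟩, hmax⟩ := exists_max_then_min hex
    (fun E => Fintype.card E.Top) (fun E => Fintype.card E.R.Cell) (∑ β, l β)
    (fun E hE => by rw [← E.sum_count]; exact Finset.sum_le_sum fun β _ => hE.1 β)
  refine ⟨E, hE, hs, fun E' hE' hs' g hg hmap hinj => ?_⟩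
  have hinj' : Function.Injective (mapTop hmap) := fun ρ ρ' h =>
    hinj ρ ρ' (congrArg Subtype.val h)
  obtain ⟨hcard, hW⟩ := hmax E' ⟨hE', hs'⟩ (Fintype.card_le_of_injective _ hinj')
  have hsurj := ((Fintype.bijective_iff_injective_and_card _).mpr ⟨hinj', hcard.symm⟩).2
  have hgs := surjective_of_mapTop_surjective hg hmap hsurj
  exact (Fintype.bijective_iff_surjective_and_card g).mpr
    ⟨hgs, le_antisymm hW (Fintype.card_le_of_surjective g hgs)⟩

/-- If the orientations are compatible, the maximally connected piece can be chosen as a full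
component of the available error cells. -/
theorem exists_isMaximalIn_of_compatible (o : Orientation V) (n : ℕ) (u : Cell T k → ℤˣ)
    {l : Cell T k → ℕ} (hl : ∃ β, 0 < l β) (hcomp : PCompatible o l u) :
    ∃ E : PError T o n k, (∀ β, E.count β ≤ l β) ∧ (∀ ρ : E.Top, E.sign ρ = u (E.cell ρ)) ∧
      E.IsMaximalIn l u ∧
      (∀ (γ : Cell T (k + 1)) (β β' : Cell T k), β.1 ⊆ γ.1 → β'.1 ⊆ γ.1 → 0 < l β → 0 < l β' →
        E.count β = E.count β') ∧
      ∀ γ : Cell T (k + 1), (∃ τ, E.IsBoundary τ ∧ E.map τ = DualCell.ofCell γ) →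
        ∃ β : Cell T k, β.1 ⊆ γ.1 ∧ 0 < l β ∧ ∀ β', β' ≠ β → β'.1 ⊆ γ.1 → l β' = 0 := by
  obtain ⟨β₀, hβ₀⟩ := hl
  obtain ⟨C, hCS, hβC, hclosed, hconn⟩ := exists_component (r := PAdj (T := T) (k := k))
    (S := {β | 0 < l β}) (fun a b ⟨γ, h, h'⟩ => ⟨γ, h', h⟩) hβ₀
  obtain ⟨E, hinj, hs, hC⟩ := exists_embedded_pError o n u ⟨β₀, hβC⟩
    (fun β hβ β' hβ' γ hne => hcomp β β' γ hne (hCS hβ) (hCS hβ')) hconn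
  have hmem : ∀ ρ, E.cell ρ ∈ C := fun ρ => (hC _).mpr ⟨ρ, rfl⟩
  refine ⟨E, count_le_of_forall_pos hinj fun ρ => hCS (hmem ρ), hs,
    isMaximalIn_of_closed hinj fun ρ β hβ hadj => (hC β).mp (hclosed _ (hmem ρ) β hβ hadj), ?_, ?_⟩
  · intro γ β β' h h' hβ hβ'
    by_cases hm : β ∈ C
    · obtain ⟨ρ, rfl⟩ := (hC β).mp hm
      obtain ⟨ρ', rfl⟩ := (hC β').mp (hclosed _ hm β' hβ' ⟨γ, h, h'⟩)
      rw [count_eq_one hinj, count_eq_one hinj]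
    · have hm' : β' ∉ C := fun hm' => hm (hclosed _ hm' β hβ ⟨γ, h', h⟩)
      rw [count_eq_zero fun hex => hm ((hC β).mpr hex),
        count_eq_zero fun hex => hm' ((hC β').mpr hex)]
  · rintro γ ⟨τ, ⟨-, ρ, hρ, huniq⟩, hγ⟩
    have hsub : (E.cell ρ).1 ⊆ γ.1 := (E.ofCell_le_map_iff ρ γ).mp (hγ ▸ E.map_mono _ _ hρ)
    refine ⟨E.cell ρ, hsub, hCS (hmem ρ), fun β' hne hβ' => ?_⟩
    by_contra h0
    obtain ⟨ρ', rfl⟩ := (hC β').mp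
      (hclosed _ (hmem ρ) β' (Nat.pos_of_ne_zero h0) ⟨γ, hsub, hβ'⟩)
    -- The second cell also has a facet over `γ̂`; as `E` is embedded, it is `τ` itself, which lies
    -- in only one top cell.
    obtain ⟨y, ⟨hy, hyγ⟩, -⟩ := E.map_lift ρ'.1 _ ((E.ofCell_le_map_iff ρ' γ).mpr hβ')
    rw [hinj (hyγ.trans hγ.symm)] at hy
    exact hne (by rw [huniq ρ' hy])

end PError

/-! ### Decompositions of sets of errors -/

section Decompositions

variable {V : Type u} {T : AbstractSimplicialComplex V} {n k : ℕ}

/-- All top cells over `b` carry the prescribed sign `u b`, so there is no cancellation between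
layers and the chain records the multiplicity. -/
theorem sum_ite_eq_mul_ncard {ι κ : Type*} [Fintype ι] (f : ι → κ) (s : ι → ℤˣ) (u : κ → ℤˣ)
    (h : ∀ i, s i = u (f i)) (b : κ) :
    ∑ i, (if f i = b then (s i : ℤ) else 0) = u b * ({i | f i = b}.ncard : ℤ) := by
  have : ∀ i, (if f i = b then (s i : ℤ) else 0) = if f i = b then (u b : ℤ) else 0 := fun i => by
    split_ifs with hi
    · rw [h, hi]
    · rfl
  rw [Finset.sum_congr rfl fun i _ => this i, ← Finset.sum_filter, Finset.sum_const, nsmul_eq_mul,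
    mul_comm, Set.ncard_eq_toFinset_card']
  congr 3
  ext
  simp

theorem IsVDecomposition.sum_chain {o : Orientation V} {deg : Cell T k → ℕ} {u : Cell T k → ℤˣ}
    {N : ℕ} {R : Fin N → VError T k} (h : IsVDecomposition o deg u R) (β : Cell T k) :
    ∑ j, (R j).chain o β = (u β : ℤ) * deg β := by
  rw [← h.1 β, Nat.cast_sum, Finset.mul_sum]
  exact Finset.sum_congr rfl fun j _ => sum_ite_eq_mul_ncard _ _ u (h.2.1 j) β

variable [Fintype V]

theorem exists_isVDecomposition (o : Orientation V) (deg : Cell T k → ℕ) (u : Cell T k → ℤˣ) :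
    ∃ (N : ℕ) (R : Fin N → VError T k), IsVDecomposition o deg u R ∧
      (VCompatible o deg u → ∀ α : Cell T (k - 1),
        (∃ j, ∃ τ, (R j).IsBoundary τ ∧ (R j).cell τ = α) →
        ∃ β : Cell T k, α.1 ⊆ β.1 ∧ 0 < deg β ∧ ∀ β', β' ≠ β → α.1 ⊆ β'.1 → deg β' ≠ deg β) := by
  obtain ⟨N, R, h1, h2, h3, h4⟩ := exists_decomposition (X := VError T k) (κ := Cell T (k - 1))
    VError.count (fun E => ∀ ρ : Cell E.R k, E.sign o ρ = u (E.cell ρ))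
    (fun E l => E.IsMaximalIn o l u) (fun E α => ∃ τ, E.IsBoundary τ ∧ E.cell τ = α)
    (fun α β => α.1 ⊆ β.1) (fun l => VCompatible o l u)
    (fun l l' hl h β β' α hne hβ hβ' => h β β' α hne (hβ.trans_le (hl β)) (hβ'.trans_le (hl β')))
    (fun l hl => by
      have hpos : ∀ E : VError T k, ∃ β, 0 < E.count β := fun E => by
        obtain ⟨ρ⟩ := E.isPseudomanifold.nonempty
        exact ⟨_, E.count_pos ρ⟩
      -- With compatible orientations the piece must be a full component, since the comparison of
      -- degrees relies on it; otherwise any maximally connected piece will do.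
      by_cases hc : VCompatible o l u
      · obtain ⟨E, h1, h2, h3, h4, h5⟩ := VError.exists_isMaximalIn_of_compatible o u hl hc
        exact ⟨E, h1, hpos E, h2, h3, fun _ => ⟨h4, h5⟩⟩
      · obtain ⟨E, h1, h2, h3⟩ := VError.exists_isMaximalIn o u hl
        exact ⟨E, h1, hpos E, h2, h3, fun h => absurd h hc⟩) deg
  exact ⟨N, R, ⟨h1, h2, h3⟩, h4⟩

theorem exists_isPDecomposition (o : Orientation V) (n : ℕ) (deg : Cell T k → ℕ)
    (u : Cell T k → ℤˣ) :
    ∃ (N : ℕ) (S : Fin N → PError T o n k), IsPDecomposition deg u S ∧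
      (PCompatible o deg u → ∀ γ : Cell T (k + 1),
        (∃ j, ∃ τ, (S j).IsBoundary τ ∧ (S j).map τ = DualCell.ofCell γ) →
        ∃ β : Cell T k, β.1 ⊆ γ.1 ∧ 0 < deg β ∧ ∀ β', β' ≠ β → β'.1 ⊆ γ.1 → deg β' ≠ deg β) := by
  obtain ⟨N, S, h1, h2, h3, h4⟩ := exists_decomposition (X := PError T o n k)
    (κ := Cell T (k + 1))
    PError.count (fun E => ∀ ρ : E.Top, E.sign ρ = u (E.cell ρ))
    (fun E l => E.IsMaximalIn l u) (fun E γ => ∃ τ, E.IsBoundary τ ∧ E.map τ = DualCell.ofCell γ)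
    (fun γ β => β.1 ⊆ γ.1) (fun l => PCompatible o l u)
    (fun l l' hl h β β' γ hne hβ hβ' => h β β' γ hne (hβ.trans_le (hl β)) (hβ'.trans_le (hl β')))
    (fun l hl => by
      have hpos : ∀ E : PError T o n k, ∃ β, 0 < E.count β := fun E => by
        obtain ⟨ρ⟩ := E.nonempty
        exact ⟨_, E.count_pos ρ⟩
      by_cases hc : PCompatible o l u
      · obtain ⟨E, h1, h2, h3, h4, h5⟩ := PError.exists_isMaximalIn_of_compatible o n u hl hc
        exact ⟨E, h1, hpos E, h2, h3, fun _ => ⟨h4, h5⟩⟩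
      · obtain ⟨E, h1, h2, h3⟩ := PError.exists_isMaximalIn o n u hl
        exact ⟨E, h1, hpos E, h2, h3, fun h => absurd h hc⟩) deg
  exact ⟨N, S, ⟨h1, h2, h3⟩, h4⟩

theorem IsPDecomposition.sum_chain {o : Orientation V} {deg : Cell T k → ℕ} {u : Cell T k → ℤˣ}
    {N : ℕ} {S : Fin N → PError T o n k} (h : IsPDecomposition deg u S) (β : Cell T k) :
    ∑ j, (S j).chain β = (u β : ℤ) * deg β := by
  rw [← h.1 β, Nat.cast_sum, Finset.mul_sum]
  exact Finset.sum_congr rfl fun j _ => sum_ite_eq_mul_ncard _ _ u (h.2.1 j) β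

theorem prod_ofFn_map_ofAdd {A M : Type*} [AddCommMonoid A] [Monoid M] (φ : Multiplicative A →* M)
    {N : ℕ} (a : Fin N → A) :
    (List.ofFn fun j => φ (.ofAdd (a j))).prod = φ (.ofAdd (∑ j, a j)) := by
  rw [ofAdd_sum, ← List.prod_ofFn, map_list_prod, List.map_ofFn]
  rfl

theorem IsVDecomposition.prod_operator {o : Orientation V} {deg : Cell T k → ℕ}
    {u : Cell T k → ℤˣ} {N : ℕ} {R : Fin N → VError T k} (h : IsVDecomposition o deg u R) (d : ℕ) :
    (List.ofFn fun j => (R j).operator o d).prod = errorX (fun β => (u β : ℤ) * deg β) := by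
  simp only [VError.operator_eq_transl, prod_ofFn_map_ofAdd, errorX_eq_transl]
  congr 2
  funext β
  rw [← h.sum_chain β]
  simp

theorem IsPDecomposition.prod_operator {o : Orientation V} {deg : Cell T k → ℕ}
    {u : Cell T k → ℤˣ} {N : ℕ} {S : Fin N → PError T o n k} (h : IsPDecomposition deg u S)
    {d : ℕ} {ζ : Circle} (hζ : ζ ^ d = 1) :
    (List.ofFn fun j => (S j).operator d ζ).prod = errorZ ζ (fun β => (u β : ℤ) * deg β) := by
  simp only [PError.operator_eq_phase _ hζ, prod_ofFn_map_ofAdd, errorZ_eq_phase hζ]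
  congr 2
  funext β
  rw [← h.sum_chain β]
  simp

theorem IsVDecomposition.boundary_eq {o : Orientation V} {deg : Cell T k → ℕ}
    {u : Cell T k → ℤˣ} {N : ℕ} {R : Fin N → VError T k} (h : IsVDecomposition o deg u R)
    (α : Cell T (k - 1)) :
    boundary o (fun β => (u β : ℤ) * deg β) α = ∑ j, (R j).boundaryChain o α := by
  simp only [← h.sum_chain, ← VError.boundary_chain, boundary, Finset.mul_sum]
  exact Finset.sum_comm

theorem IsPDecomposition.dualBoundary_eq {o : Orientation V} {deg : Cell T k → ℕ}
    {u : Cell T k → ℤˣ} {N : ℕ} {S : Fin N → PError T o n k} (h : IsPDecomposition deg u S)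
    (γ : Cell T (k + 1)) :
    dualBoundary o (fun β => (u β : ℤ) * deg β) γ = ∑ j, (S j).boundaryChain γ := by
  simp only [← h.sum_chain, ← PError.dualBoundary_chain, dualBoundary, Finset.mul_sum]
  exact Finset.sum_comm

/-- The coefficient at `α` is a sum of degrees with the signs that the errors induce on `α`, and
compatibility is the alternation of these signs. -/
theorem VCompatible.boundary_ne_zero {o : Orientation V} {deg : Cell T k → ℕ} {u : Cell T k → ℤˣ}
    (h : VCompatible o deg u) {d : ℕ} (hd : d ≠ 0 → ∀ β, deg β < d) {α : Cell T (k - 1)}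
    (hα : ∃ β : Cell T k, α.1 ⊆ β.1 ∧ 0 < deg β ∧ ∀ β', β' ≠ β → α.1 ⊆ β'.1 → deg β' ≠ deg β) :
    ((boundary o (fun β => (u β : ℤ) * deg β) α : ℤ) : ZMod d) ≠ 0 := by
  obtain ⟨β, hβ, hpos, hne⟩ := hα
  have hsub : ∀ β : Cell T k, (u β : ℤ) * o.inc β.1 α.1 ≠ 0 → α.1 ⊆ β.1 := fun β h =>
    o.subset_of_inc_ne_zero (right_ne_zero_of_mul h)
  have hsum : boundary o (fun β => (u β : ℤ) * deg β) α
      = ∑ β : Cell T k, ((u β : ℤ) * o.inc β.1 α.1) * deg β :=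
    Finset.sum_congr rfl fun β _ => by rw [Int.cast_id]; ring
  obtain ⟨s, hs⟩ := o.exists_unit_inc hβ (by
    have h1 := α.2.2
    have h2 := β.2.2
    omega)
  rw [hsum]
  exact intCast_sum_ne_zero_of_alternating _ deg hd
    (fun i j hij hi hj hxi hxj => h i j α hij hi hj (hsub i hxi) (hsub j hxj))
    (u β * s) (by rw [hs, Units.val_mul]) hpos fun j hj hxj => hne j hj (hsub j hxj)

theorem PCompatible.dualBoundary_ne_zero {o : Orientation V} {deg : Cell T k → ℕ}
    {u : Cell T k → ℤˣ} (h : PCompatible o deg u) {d : ℕ} (hd : d ≠ 0 → ∀ β, deg β < d)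
    {γ : Cell T (k + 1)}
    (hγ : ∃ β : Cell T k, β.1 ⊆ γ.1 ∧ 0 < deg β ∧ ∀ β', β' ≠ β → β'.1 ⊆ γ.1 → deg β' ≠ deg β) :
    ((dualBoundary o (fun β => (u β : ℤ) * deg β) γ : ℤ) : ZMod d) ≠ 0 := by
  obtain ⟨β, hβ, hpos, hne⟩ := hγ
  have hsub : ∀ β : Cell T k, (u β : ℤ) * o.inc γ.1 β.1 ≠ 0 → β.1 ⊆ γ.1 := fun β h =>
    o.subset_of_inc_ne_zero (right_ne_zero_of_mul h)
  have hsum : dualBoundary o (fun β => (u β : ℤ) * deg β) γ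
      = ∑ β : Cell T k, ((u β : ℤ) * o.inc γ.1 β.1) * deg β :=
    Finset.sum_congr rfl fun β _ => by rw [Int.cast_id]; ring
  obtain ⟨s, hs⟩ := o.exists_unit_inc hβ (card_eq_card_add_one γ β)
  rw [hsum]
  exact intCast_sum_ne_zero_of_alternating _ deg hd
    (fun i j hij hi hj hxi hxj => h i j γ hij hi hj (hsub i hxi) (hsub j hxj))
    (u β * s) (by rw [hs, Units.val_mul]) hpos fun j hj hxj => hne j hj (hsub j hxj)

end Decompositions

/-! ### Single errors -/

section Single

variable {V : Type u} [Fintype V] {T : AbstractSimplicialComplex V} {k : ℤ} {d : ℕ}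
  (o : Orientation V) {ζ : Circle} (hζ : IsPrimitiveRoot ζ d)

include hζ in
theorem broken_stabV_transl_iff {ψ : State T k d} (hψ : ψ ∈ codeSpace o ζ) (h0 : ψ ≠ 0)
    (a : Cell T k → ZMod d) (α : Cell T (k - 1)) :
    Broken (stabV o ζ α) (transl d T k (.ofAdd a) ψ) ↔ boundary o a α ≠ 0 := by
  simpa using broken_stabV_iff o hζ hψ h0 a 0 α

include hζ in
theorem not_broken_stabP_transl {ψ : State T k d} (hψ : ψ ∈ codeSpace o ζ) (h0 : ψ ≠ 0)
    (a : Cell T k → ZMod d) (γ : Cell T (k + 1)) :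
    ¬ Broken (stabP o γ) (transl d T k (.ofAdd a) ψ) := by
  have := broken_stabP_iff o hζ hψ h0 a 0 γ
  simpa [dualBoundary] using this

theorem broken_stabP_phase_iff {ψ : State T k d} (hψ : ψ ∈ codeSpace o ζ) (h0 : ψ ≠ 0)
    (b : Cell T k → ZMod d) (γ : Cell T (k + 1)) :
    Broken (stabP o γ) (phase T k ζ hζ.pow_eq_one (.ofAdd b) ψ) ↔ dualBoundary o b γ ≠ 0 := by
  simpa using broken_stabP_iff o hζ hψ h0 0 b γ

theorem not_broken_stabV_phase {ψ : State T k d} (hψ : ψ ∈ codeSpace o ζ) (h0 : ψ ≠ 0)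
    (b : Cell T k → ZMod d) (α : Cell T (k - 1)) :
    ¬ Broken (stabV o ζ α) (phase T k ζ hζ.pow_eq_one (.ofAdd b) ψ) := by
  have := broken_stabV_iff o hζ hψ h0 0 b α
  simpa [boundary] using this

end Single

end HomologyCode

end

/-! ### Assembly of the three parts of the lemma. -/

open HomologyCode in
theorem mainTheorem3 {V : Type u} [Fintype V] (T : AbstractSimplicialComplex V) (o : Orientation V)
    (n k d : ℕ) (hT : IsPure T n) (ζ : Circle) (hζ : IsPrimitiveRoot ζ d) :
    -- one `V`-error sub-pseudo-manifold
    (∀ R : VError T k,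
      (∀ α : Cell T (k - 1), boundary o (R.chain o) α = R.boundaryChain o α) ∧
      (∀ ψ ∈ codeSpace (T := T) (k := k) (d := d) o ζ, ψ ≠ 0 →
        (∀ α : Cell T (k - 1), Broken (stabV o ζ α) (R.operator o d ψ) ↔
          boundary o (fun β => (R.chain o β : ZMod d)) α ≠ 0) ∧
        (∀ γ : Cell T (k + 1), ¬ Broken (stabP o γ) (R.operator o d ψ))) ∧
      (d ≠ 1 → Function.Injective R.map → ∀ α : Cell T (k - 1),
        boundary o (fun β => (R.chain o β : ZMod d)) α ≠ 0 ↔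
          ∃ τ, R.IsBoundary τ ∧ R.cell τ = α) ∧
      (∀ a : Cell T k → ℤ,
        (∀ ψ ∈ codeSpace (T := T) (k := k) (d := d) o ζ, errorX a ψ = R.operator o d ψ) ↔
        ∃ c : Cell T (k + 1) → ZMod d, ∀ β, (a β : ZMod d) = R.chain o β + boundary o c β)) ∧
    -- one `P`-error sub-cellulation
    (∀ S : PError T o n k,
      (∀ γ : Cell T (k + 1), dualBoundary o S.chain γ = S.boundaryChain γ) ∧
      (∀ ψ ∈ codeSpace (T := T) (k := k) (d := d) o ζ, ψ ≠ 0 →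
        (∀ γ : Cell T (k + 1), Broken (stabP o γ) (S.operator d ζ ψ) ↔
          dualBoundary o (fun β => (S.chain β : ZMod d)) γ ≠ 0) ∧
        (∀ α : Cell T (k - 1), ¬ Broken (stabV o ζ α) (S.operator d ζ ψ))) ∧
      (d ≠ 1 → Function.Injective S.map → ∀ γ : Cell T (k + 1),
        dualBoundary o (fun β => (S.chain β : ZMod d)) γ ≠ 0 ↔
          ∃ τ, S.IsBoundary τ ∧ S.map τ = DualCell.ofCell γ) ∧
      (∀ a : Cell T k → ℤ,
        ((∃ c : Cell T (k - 1) → ZMod d, ∀ β, (a β : ZMod d) = S.chain β + dualBoundary o c β) →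
          ∀ ψ ∈ codeSpace (T := T) (k := k) (d := d) o ζ, errorZ ζ a ψ = S.operator d ζ ψ) ∧
        (d ≠ 0 →
          (∀ ψ ∈ codeSpace (T := T) (k := k) (d := d) o ζ, errorZ ζ a ψ = S.operator d ζ ψ) →
          ∃ c : Cell T (k - 1) → ZMod d, ∀ β, (a β : ZMod d) = S.chain β + dualBoundary o c β))) ∧
    -- decomposition of an arbitrary set of `V`- and `P`-errors
    (∀ (degV degP : Cell T k → ℕ) (uV uP : Cell T k → ℤˣ),
      (d ≠ 0 → ∀ β, degV β < d ∧ degP β < d) →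
      ∃ (N M : ℕ) (R : Fin N → VError T k) (S : Fin M → PError T o n k),
        IsVDecomposition o degV uV R ∧ IsPDecomposition degP uP S ∧
        (List.ofFn fun j => (R j).operator o d).prod = errorX (fun β => (uV β : ℤ) * degV β) ∧
        (List.ofFn fun j => (S j).operator d ζ).prod = errorZ ζ (fun β => (uP β : ℤ) * degP β) ∧
        ∀ ψ ∈ codeSpace (T := T) (k := k) (d := d) o ζ, ψ ≠ 0 →
          ∀ φ, φ = errorX (fun β => (uV β : ℤ) * degV β)
              (errorZ ζ (fun β => (uP β : ℤ) * degP β) ψ) →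
          (∀ α : Cell T (k - 1), Broken (stabV o ζ α) φ ↔
            ((∑ j, (R j).boundaryChain o α : ℤ) : ZMod d) ≠ 0) ∧
          (∀ γ : Cell T (k + 1), Broken (stabP o γ) φ ↔
            ((∑ j, (S j).boundaryChain γ : ℤ) : ZMod d) ≠ 0) ∧
          (VCompatible o degV uV → ∀ α : Cell T (k - 1), Broken (stabV o ζ α) φ ↔
            ∃ j, ∃ τ, (R j).IsBoundary τ ∧ (R j).cell τ = α) ∧
          (PCompatible o degP uP → ∀ γ : Cell T (k + 1), Broken (stabP o γ) φ ↔
            ∃ j, ∃ τ, (S j).IsBoundary τ ∧ (S j).map τ = DualCell.ofCell γ)) := by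
  refine ⟨fun R => ⟨R.boundary_chain o, fun ψ hψ h0 => ?_,
    R.boundary_chain_ne_zero_iff_of_injective o, fun a => ?_⟩,
    fun S => ⟨S.dualBoundary_chain, fun ψ hψ h0 => ?_,
      S.dualBoundary_chain_ne_zero_iff_of_injective, fun a => ?_⟩,
    fun degV degP uV uP hdeg => ?_⟩
  · rw [R.operator_eq_transl]
    exact ⟨fun α => broken_stabV_transl_iff o hζ hψ h0 _ α,
      fun γ => not_broken_stabP_transl o hζ hψ h0 _ γ⟩
  · rw [R.operator_eq_transl, errorX_eq_transl]
    exact transl_eq_on_codeSpace_iff o hζ _ _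
  · rw [S.operator_eq_phase hζ.pow_eq_one]
    exact ⟨fun γ => broken_stabP_phase_iff o hζ hψ h0 _ γ,
      fun α => not_broken_stabV_phase o hζ hψ h0 _ α⟩
  · rw [S.operator_eq_phase hζ.pow_eq_one, errorZ_eq_phase hζ.pow_eq_one]
    exact ⟨fun h ψ hψ => phase_eq_on_codeSpace o hζ h hψ,
      fun hd h => exists_dualBoundary_of_phase_eq_on_codeSpace o hζ hd h⟩
  · obtain ⟨N, R, hR, hRc⟩ := exists_isVDecomposition o degV uV
    obtain ⟨M, S, hS, hSc⟩ := exists_isPDecomposition o n degP uP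
    refine ⟨N, M, R, S, hR, hS, hR.prod_operator d, hS.prod_operator hζ.pow_eq_one, ?_⟩
    rintro ψ hψ h0 φ rfl
    rw [errorX_eq_transl, errorZ_eq_phase hζ.pow_eq_one]
    -- The `V`-stabilizers see only the translation and the `P`-stabilizers only the phase, so the
    -- two types of error do not interfere.
    have hV : ∀ α : Cell T (k - 1), _ := fun α => broken_stabV_iff o hζ hψ h0
      (fun β => (((uV β : ℤ) * degV β : ℤ) : ZMod d))
      (fun β => (((uP β : ℤ) * degP β : ℤ) : ZMod d)) α
    have hP : ∀ γ : Cell T (k + 1), _ := fun γ => broken_stabP_iff o hζ hψ h0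
      (fun β => (((uV β : ℤ) * degV β : ℤ) : ZMod d))
      (fun β => (((uP β : ℤ) * degP β : ℤ) : ZMod d)) γ
    simp only [boundary_intCast, hR.boundary_eq] at hV
    simp only [dualBoundary_intCast, hS.dualBoundary_eq] at hP
    refine ⟨hV, hP, fun hc α => (hV α).trans ⟨fun h => ?_, fun h => ?_⟩,
      fun hc γ => (hP γ).trans ⟨fun h => ?_, fun h => ?_⟩⟩
    -- A nonvanishing total coefficient needs a piece with nonvanishing boundary chain at `α`, hence
    -- a boundary cell there.
    · obtain ⟨j, -, hj⟩ := Finset.exists_ne_zero_of_sum_ne_zero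
        (fun h' => h (by rw [h', Int.cast_zero]) : ∑ j, (R j).boundaryChain o α ≠ 0)
      exact ⟨j, (R j).exists_isBoundary_of_boundaryChain_ne_zero hj⟩
    · rw [← hR.boundary_eq]
      exact hc.boundary_ne_zero (fun hd β => (hdeg hd β).1) (hRc hc α h)
    · obtain ⟨j, -, hj⟩ := Finset.exists_ne_zero_of_sum_ne_zero
        (fun h' => h (by rw [h', Int.cast_zero]) : ∑ j, (S j).boundaryChain γ ≠ 0)
      exact ⟨j, (S j).exists_isBoundary_of_boundaryChain_ne_zero hj⟩
    · rw [← hS.dualBoundary_eq]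
      exact hc.dualBoundary_ne_zero (fun hd β => (hdeg hd β).2) (hSc hc γ h)
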